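/- Setting. Consider a finite Markov decision process with state space $\mathcal X$, action space $\mathcal A$, transition probabilities $P(x'\mid a,x)$, reward $r(x,a)$ and discount factor $\gamma\in(0,1)$, a target policy $\pi_*$, a behavioral policy $\pi_b$, and a feature map $\phi:\mathcal X\to\mathbb R^d$. Write $\rho(x,a)=\pi_*(a\mid x)/\pi_b(a\mid x)$. Let $x_1,a_1,x_2,a_2,\dots$ be generated by $\pi_b$, where the state chain under $\pi_b$ is irreducible and aperiodic with unique steady-state distribution $\mu$, $\mu(x)>0$ for all $x$, and $x_1\sim\mu$. Put $\phi_n=\phi(x_n)$, $r_n=r(x_n,a_n)$, $\rho_n=\rho(x_n,a_n)$, and assume that, with probability one and for all $n$, $|r_n|\le r_{\max}$, $\|\phi_n\|\le 1$ and $\rho_n\le\rho_{\max}$, where $r_{\max},\rho_{\max}>0$. With expectations over $x\sim\mu$, $a\sim\pi_b(\cdot\mid x)$, $x'\sim P(\cdot\mid a,x)$, let $$A=\mathbb E[\rho(x,a)\phi(x)\{\gamma\phi(x')-\phi(x)\}^\top],\quad C=-\mathbb E[\rho(x,a)\phi(x)\phi(x)^\top],\quad b=\mathbb E[\rho(x,a)r(x,a)\phi(x)].$$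 Assume that $A$ and $C$ are nonsingular, let $\lambda_c>0$ be the minimum absolute eigenvalue of $C$, and let $\lambda_u,\lambda_w$ satisfy $\lambda_{\max}(2C)\le\lambda_u<0$ and $\lambda_{\max}(2A^\top C^{-1}A)\le\lambda_w<0$. Let $w_*=-A^{-1}b$. Algorithm. Let $\Pi_R$ be the projection onto the closed Euclidean ball of radius $R$. Given step sizes $c_\alpha,c_\beta>0$, radii $R_w,R_u>0$ and deterministic initial values $\|w_1\|\le R_w$, $\|u_1\|\le R_u$, projected implicit TDC is $$w_{n+1}=\Pi_{R_w}\bigl[w_n+\alpha_n'\rho_n\delta_n\phi_n-c_\alpha\rho_n\gamma(\phi_n^\top u_n)\{\phi_{n+1}-\alpha_n'\rho_n(\phi_n^\top\phi_{n+1})\phi_n\}\bigr],$$ $$u_{n+1}=\Pi_{R_u}\bigl[u_n+\beta_n'\rho_n\delta_n\phi_n-\beta_n'\rho_n\phi_n\phi_n^\top u_n\bigr],$$ with $\delta_n=r_n+\gamma\phi_{n+1}^\top w_n-\phi_n^\top w_n$, $\alpha_n'=\frac{c_\alpha}{1+c_\alpha\rho_n\|\phi_n\|^2}$, $\beta_n'=\frac{c_\beta}{1+c_\beta\rho_n\|\phi_n\|^2}$.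 The tracking error is $v_n=u_n+C^{-1}(b+Aw_n)$. Theorem. There are constants $m>0$, $\rho\in(0,1)$ with $$\sup_{x}d_{\mathrm{TV}}\{\mathbb P(x_n\in\cdot\mid x_1=x),\mu\}\le m\rho^n\quad\text{for all } n\ge1.\qquad(*)$$ Let $(m,\rho)$ be any constants satisfying $(*)$, and let $\tau_\epsilon=\min\{n\ge1: m\rho^n\le\epsilon\}$ be the mixing time. Suppose $R_w\ge\|w_*\|$, $R_u\ge 2\rho_{\max}(\gamma+1)R_w/\lambda_c$, $c_\alpha(|\lambda_w|-\rho_{\max})<1$ and $c_\beta(|\lambda_u|-\rho_{\max})<1$, and put $\underline\alpha=\frac{c_\alpha}{1+c_\alpha\rho_{\max}}$, $\underline\beta=\frac{c_\beta}{1+c_\beta\rho_{\max}}$. Then there are constants $C_v,C_w\ge0$, not depending on $n$, $w_1$, $u_1$, such that for all $n\ge0$ $$\mathbb E\|v_{n+1}\|^2\le(1-\underline\beta|\lambda_u|)^n\|v_1\|^2+C_v,\qquad \mathbb E\|w_{n+1}-w_*\|^2\le(1-\underline\alpha|\lambda_w|)^n\|w_1-w_*\|^2+C_w,$$ and $$C_v\le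 K\Bigl(\max\{c_\beta\tau_{c_\beta},c_\beta^2\tau_{c_\beta}\}+\max\{c_\alpha,c_\alpha^2\}+\max\{c_\alpha/c_\beta,\,c_\alpha^2/c_\beta\}\Bigr),$$ $$C_w\le K\Bigl(\max\{c_\alpha,c_\alpha^4\}+\sqrt{C_v}+c_\alpha\sqrt{C_v}+\max\{c_\alpha,c_\alpha^3\}\,\tau_{c_\alpha}\Bigr),$$ where $K>0$ depends only on $\rho_{\max},r_{\max},\lambda_c,\lambda_u,\lambda_w,R_w,R_u$ (in particular not on $c_\alpha,c_\beta,m,\rho$, $n$). -/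

import Mathlib

open MeasureTheory
open scoped Matrix

noncomputable section

/-- Feature / parameter vectors: `ℝ^d` with the Euclidean norm. -/
abbrev Vec (d : ℕ) : Type := EuclideanSpace ℝ (Fin d)

/-- A (stochastic) policy: `prob x a` is the probability of action `a` in state `x`. -/
structure Policy (X A : Type*) [Fintype A] where
  prob : X → A → ℝ
  nonneg : ∀ x a, 0 ≤ prob x a
  sum_one : ∀ x, ∑ a, prob x a = 1

/-- An off-policy evaluation problem with linear features: a finite Markov decision process with
discount factor in `(0,1)`, a target policy, a behavioral policy, a feature map, and a distribution
`mu` on the states (the steady-state distribution, see `TDCProblem.Ergodic`). -/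
structure TDCProblem (X A : Type*) [Fintype X] [Fintype A] (d : ℕ) where
  /-- `trans a x y` is the transition probability `P(y | a, x)`. -/
  trans : A → X → X → ℝ
  trans_nonneg : ∀ a x y, 0 ≤ trans a x y
  trans_sum : ∀ a x, ∑ y, trans a x y = 1
  reward : X → A → ℝ
  γ : ℝ
  γ_pos : 0 < γ
  γ_lt_one : γ < 1
  target : Policy X A
  behavior : Policy X A
  φ : X → Vec d
  mu : X → ℝ

/-- `mu` is a stationary probability distribution of the transition matrix `Q`. -/
structure IsStationaryDist {X : Type*} [Fintype X] (Q : Matrix X X ℝ) (mu : X → ℝ) : Prop where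
  nonneg : ∀ x, 0 ≤ mu x
  sum_one : ∑ x, mu x = 1
  invariant : ∀ y, ∑ x, mu x * Q x y = mu y

/-- Total variation distance of two distributions on a finite set. -/
def tvDist {X : Type*} [Fintype X] (p q : X → ℝ) : ℝ := (1 / 2) * ∑ x, |p x - q x|

/-- Mixing time `min {n ≥ 1 : m ρ^n ≤ ε}` (over the positive integers; the set is nonempty for
`0 < ρ < 1` and `0 < ε`). -/
def mixingTime (m ρ ε : ℝ) : ℕ := sInf {n : ℕ | 1 ≤ n ∧ m * ρ ^ n ≤ ε}

/-- Projection onto the closed Euclidean ball of radius `R`. -/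
def ballProj {d : ℕ} (R : ℝ) (w : Vec d) : Vec d := if R < ‖w‖ then (R / ‖w‖) • w else w

namespace TDCProblem

variable {X A : Type*} [Fintype X] [Fintype A] {d : ℕ} (M : TDCProblem X A d)

/-- Transition matrix of the state chain under the behavioral policy. -/
def chain : Matrix X X ℝ := Matrix.of fun x y => ∑ a, M.behavior.prob x a * M.trans a x y

/-- The state chain under the behavioral policy is irreducible and aperiodic, and `M.mu` is its
unique steady-state distribution, with full support. -/
structure Ergodic [DecidableEq X] : Prop where
  irreducible : ∀ x y, ∃ n : ℕ, 0 < (M.chain ^ n) x y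
  /-- The return times to every state have greatest common divisor `1`. -/
  aperiodic : ∀ x, ∀ k : ℕ, (∀ n : ℕ, 1 ≤ n → 0 < (M.chain ^ n) x x → k ∣ n) → k = 1
  stationary : IsStationaryDist M.chain M.mu
  unique : ∀ nu : X → ℝ, IsStationaryDist M.chain nu → nu = M.mu
  pos : ∀ x, 0 < M.mu x

/-- `m > 0` and `ρ ∈ (0,1)` are constants of uniform geometric ergodicity: the law of the `n`-th
state (`n = 1, 2, …`) given that the first state is `x` is within `m ρ^n` of `mu` in total
variation. The `n`-th state is reached after `k = n - 1` transitions. -/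
structure GeomMixing [DecidableEq X] (m ρ : ℝ) : Prop where
  m_pos : 0 < m
  rate_pos : 0 < ρ
  rate_lt_one : ρ < 1
  bound : ∀ (k : ℕ) (x : X), tvDist ((M.chain ^ k) x) M.mu ≤ m * ρ ^ (k + 1)

/-- Importance weight `π_*(a|x) / π_b(a|x)`; actions with `π_b(a|x) = 0` are never taken. -/
def weight (x : X) (a : A) : ℝ := M.target.prob x a / M.behavior.prob x a

/-- Rewards along the data are bounded by `rmax` with probability one. -/
def BoundedReward (rmax : ℝ) : Prop :=
  ∀ x a, 0 < M.behavior.prob x a → |M.reward x a| ≤ rmax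

/-- Normalized features. -/
def NormalizedFeatures : Prop := ∀ x, ‖M.φ x‖ ≤ 1

/-- Importance weights along the data are bounded by `ρmax`. -/
def BoundedWeight (ρmax : ℝ) : Prop :=
  ∀ x a, 0 < M.behavior.prob x a → M.weight x a ≤ ρmax

/-- Stationary probability of the transition `(x, a, x')` under the behavioral policy. -/
def transWeight (x : X) (a : A) (x' : X) : ℝ :=
  M.mu x * M.behavior.prob x a * M.trans a x x'

/-- `A = E[ρ(x,a) φ(x) (γ φ(x') - φ(x))ᵀ]`. -/
def matA : Matrix (Fin d) (Fin d) ℝ :=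
  ∑ x, ∑ a, ∑ x', (M.transWeight x a x' * M.weight x a) •
    Matrix.vecMulVec (M.φ x).ofLp (M.γ • M.φ x' - M.φ x).ofLp

/-- `C = -E[ρ(x,a) φ(x) φ(x)ᵀ]`. -/
def matC : Matrix (Fin d) (Fin d) ℝ :=
  -∑ x, ∑ a, ∑ x', (M.transWeight x a x' * M.weight x a) •
    Matrix.vecMulVec (M.φ x).ofLp (M.φ x).ofLp

/-- `b = E[ρ(x,a) r(x,a) φ(x)]`. -/
def vecb : Vec d :=
  ∑ x, ∑ a, ∑ x', (M.transWeight x a x' * M.weight x a * M.reward x a) • M.φ x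

/-- Problem solvability: `A`, `C` nonsingular, `lamc > 0` is the minimum absolute eigenvalue of `C`,
`λ_max(2C) ≤ lamu < 0` and `λ_max(2 Aᵀ C⁻¹ A) ≤ lamw < 0`. -/
structure Solvable (lamc lamu lamw : ℝ) : Prop where
  A_nonsing : IsUnit M.matA.det
  C_nonsing : IsUnit M.matC.det
  lamc_pos : 0 < lamc
  lamc_min : IsLeast {t : ℝ | ∃ s : ℝ,
    Module.End.HasEigenvalue (Matrix.toLin' M.matC) s ∧ t = |s|} lamc
  lamu_neg : lamu < 0
  lamu_ge : ∀ s : ℝ, Module.End.HasEigenvalue (Matrix.toLin' ((2 : ℝ) • M.matC)) s → s ≤ lamu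
  lamw_neg : lamw < 0
  lamw_ge : ∀ s : ℝ, Module.End.HasEigenvalue
    (Matrix.toLin' ((2 : ℝ) • (M.matAᵀ * M.matC⁻¹ * M.matA))) s → s ≤ lamw

/-- The solution `w_* = -A⁻¹ b` of `A w + b = 0`. -/
def wStar : Vec d := -(Matrix.toEuclideanLin M.matA⁻¹ M.vecb)

/-- `u^*(w) = -C⁻¹ (b + A w)`, the stationary point of `u' = b + A w + C u`. -/
def uStar (w : Vec d) : Vec d :=
  -(Matrix.toEuclideanLin M.matC⁻¹ (M.vecb + Matrix.toEuclideanLin M.matA w))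

/-- The data `x 0, a 0, x 1, a 1, …` (time starts at `0`): a trajectory under the behavioral policy
started from the steady-state distribution, given by its finite-dimensional laws. -/
structure IsTrajectory {Ω : Type*} [MeasurableSpace Ω] (P : Measure Ω)
    (x : ℕ → Ω → X) (a : ℕ → Ω → A) : Prop where
  meas_state : ∀ n s, MeasurableSet (x n ⁻¹' {s})
  meas_action : ∀ n b, MeasurableSet (a n ⁻¹' {b})
  law : ∀ (n : ℕ) (s : ℕ → X) (b : ℕ → A),
    P.real {ω | (∀ k ≤ n, x k ω = s k) ∧ ∀ k < n, a k ω = b k} =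
      M.mu (s 0) * ∏ k ∈ Finset.range n,
        (M.behavior.prob (s k) (b k) * M.trans (b k) (s k) (s (k + 1)))

/-- The adapted step size `c / (1 + c ρ(x,a) ‖φ(x)‖²)`. -/
def adaptStep (c : ℝ) (x : X) (a : A) : ℝ := c / (1 + c * M.weight x a * ‖M.φ x‖ ^ 2)

/-- Temporal difference error of the transition `(x, a, x')` at the parameter `w`. -/
def tdError (x : X) (a : A) (x' : X) (w : Vec d) : ℝ :=
  M.reward x a + M.γ * inner ℝ (M.φ x') w - inner ℝ (M.φ x) w

/-- One step of projected implicit TDC with step sizes `cα`, `cβ` and projection radii `Rw`, `Ru`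
on the pair `p = (w, u)`, using the observed transition `(x, a, x')`. -/
def step (cα cβ Rw Ru : ℝ) (x : X) (a : A) (x' : X) (p : Vec d × Vec d) : Vec d × Vec d :=
  (ballProj Rw
    (p.1 + (M.adaptStep cα x a * M.weight x a * M.tdError x a x' p.1) • M.φ x
      - (cα * M.weight x a * M.γ * inner ℝ (M.φ x) p.2) •
        (M.φ x' - (M.adaptStep cα x a * M.weight x a * inner ℝ (M.φ x) (M.φ x')) • M.φ x)),
   ballProj Ru
    (p.2 + (M.adaptStep cβ x a * M.weight x a * M.tdError x a x' p.1) • M.φ x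
      - (M.adaptStep cβ x a * M.weight x a * inner ℝ (M.φ x) p.2) • M.φ x))

/-- The iterates `(w, u)` of projected implicit TDC with constant step sizes along the observed
states `xs` and actions `as`; index `0` is the initial guess. -/
def iter (cα cβ Rw Ru : ℝ) (w₀ u₀ : Vec d) (xs : ℕ → X) (as : ℕ → A) : ℕ → Vec d × Vec d
  | 0 => (w₀, u₀)
  | n + 1 => M.step cα cβ Rw Ru (xs n) (as n) (xs (n + 1)) (iter cα cβ Rw Ru w₀ u₀ xs as n)

/-- Tracking error `v = u - u^*(w)`. -/
def trackErr (p : Vec d × Vec d) : Vec d := p.2 - M.uStar p.1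

end TDCProblem

end

/-!
# Finite-time bounds for projected implicit TDC

The pair `(θ, x)` of the iterate `θ = (w, u)` and the current state is a Markov chain, so the
expectation of a function of `(θ_n, x_n)` is computed by the `n`-th power of a positive operator
(`TDCProblem.transfer`, `TDCProblem.integral_eq_expect`); after that the argument is free of
measure theory.

*Drift.* Up to second order in the step size, one update moves `u` along `dirU` and `w` along
`dirW`. In the steady state, `dirU` has mean `C v` with `v = u - u^*(w)`, and `dirW` at
`u = u^*(w)` has mean `Aᵀ C⁻¹ A (w - w_*)` (`mean_dirU`, `mean_dirW`). The eigenvalue assumptions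
then turn the squared errors into contractions with factors `1 - cβ |lamu|` and `1 - cα |lamw|`,
up to remainders: `v` also sees the motion of `u^*(w)`, of order `cα`, and `w` sees the tracking
error, of order `cα ‖v‖`. Since `u^*(w)` lies in the projection ball of `u`, and `w_*` in that of
`w`, projecting does no harm.

*Markovian noise.* The states are not sampled from the steady state given the past. A function of
`(θ, x)` that moves by at most `Δ` at each update and is bounded by `B` exceeds its steady-state
average by at most `2 τ Δ + 2 B ε` in mean, once `τ` steps bring the state chain `ε`-close to the
steady state (`expect_sub_mean_le`): `τ` steps back, freeze the parameter. For the tracking error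
this costs `τ (cα + cβ)`. For `w` the function used is `dirW` at `u = u^*(w)`, which does not
involve the fast variable `u`, so that only `τ cα` appears.

*Time scales.* Dividing the noise per step by the contraction rate gives `cβ τ + cα / cβ` for the
tracking error and `cα τ + √Cv` for `w`; the transient of the tracking error contributes
`cα / cβ ≤ √Cv` to the latter. This is carried out for `cα ≤ cβ ≤ 1`. Otherwise the claimed bounds
are at least a constant, and the radii of the projection balls suffice.

Geometric ergodicity comes from Doeblin's minorization: an irreducible aperiodic finite chain has a
power with positive entries (`exists_geomMixing`).
-/

noncomputable section

/-! ### Symmetric matrices and the projection onto a ball -/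

/-- Rayleigh quotient bound: an upper bound on the eigenvalues of a symmetric matrix bounds its
quadratic form. -/
theorem inner_toEuclideanLin_le_of_eigenvalue_le {d : ℕ} {S : Matrix (Fin d) (Fin d) ℝ}
    (hS : S.IsHermitian) {c : ℝ}
    (h : ∀ s : ℝ, Module.End.HasEigenvalue (Matrix.toLin' S) s → s ≤ c) (v : Vec d) :
    inner ℝ v (Matrix.toEuclideanLin S v) ≤ c * ‖v‖ ^ 2 := by
  set B := hS.eigenvectorBasis with hB
  have hsym : (Matrix.toEuclideanLin S).IsSymmetric := Matrix.isSymmetric_toEuclideanLin_iff.mpr hS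
  have hBi : ∀ i, Matrix.toEuclideanLin S (B i) = hS.eigenvalues i • B i := by
    intro i
    ext j
    have := congrFun (hS.mulVec_eigenvectorBasis i) j
    simpa [Matrix.toLpLin_apply] using this
  have hle : ∀ i, hS.eigenvalues i ≤ c := by
    intro i
    refine h _ (Module.End.hasEigenvalue_of_hasEigenvector (x := (B i).ofLp) ⟨?_, ?_⟩)
    · rw [Module.End.mem_eigenspace_iff]
      simpa using hS.mulVec_eigenvectorBasis i
    · intro h0
      have : B i = 0 := by ext j; simpa using congrFun h0 j
      exact B.orthonormal.ne_zero i this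
  have h1 : inner ℝ v (Matrix.toEuclideanLin S v)
      = ∑ i, hS.eigenvalues i * (inner ℝ v (B i)) ^ 2 := by
    rw [← B.sum_inner_mul_inner]
    refine Finset.sum_congr rfl fun i _ => ?_
    rw [← hsym, hBi, real_inner_smul_left, real_inner_comm]
    ring
  have h2 : ‖v‖ ^ 2 = ∑ i, (inner ℝ v (B i)) ^ 2 := by
    rw [← real_inner_self_eq_norm_sq, ← B.sum_inner_mul_inner]
    refine Finset.sum_congr rfl fun i _ => ?_
    rw [real_inner_comm]
    ring
  rw [h1, h2, Finset.mul_sum]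
  exact Finset.sum_le_sum fun i _ => mul_le_mul_of_nonneg_right (hle i) (sq_nonneg _)

theorem toEuclideanLin_vecMulVec {d : ℕ} (p q w : Vec d) :
    Matrix.toEuclideanLin (Matrix.vecMulVec p.ofLp q.ofLp) w = (inner ℝ q w : ℝ) • p := by
  ext i
  simp [Matrix.toLpLin_apply, Matrix.vecMulVec_mulVec, PiLp.inner_apply, dotProduct, mul_comm]

theorem toEuclideanLin_mul_apply {d : ℕ} (S T : Matrix (Fin d) (Fin d) ℝ) (w : Vec d) :
    Matrix.toEuclideanLin (S * T) w = Matrix.toEuclideanLin S (Matrix.toEuclideanLin T w) := by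
  simp [Matrix.toLpLin_mul_same]

theorem toEuclideanLin_mul_inv_apply {d : ℕ} {S : Matrix (Fin d) (Fin d) ℝ} (h : IsUnit S.det)
    (w : Vec d) : Matrix.toEuclideanLin S (Matrix.toEuclideanLin S⁻¹ w) = w := by
  rw [← toEuclideanLin_mul_apply, Matrix.mul_nonsing_inv _ h]
  simp [Matrix.toLpLin_one]

theorem norm_ballProj_le {d : ℕ} {R : ℝ} (hR : 0 ≤ R) (w : Vec d) : ‖ballProj R w‖ ≤ R := by
  unfold ballProj
  split_ifs with h
  · have hw : 0 < ‖w‖ := hR.trans_lt h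
    rw [norm_smul, Real.norm_of_nonneg (by positivity), div_mul_cancel₀ _ hw.ne']
  · exact not_lt.mp h

/-- Projecting onto the ball does not increase the distance to a point of the ball. -/
theorem norm_ballProj_sub_le {d : ℕ} {R : ℝ} (hR : 0 ≤ R) (w : Vec d) {y : Vec d}
    (hy : ‖y‖ ≤ R) : ‖ballProj R w - y‖ ≤ ‖w - y‖ := by
  unfold ballProj
  split_ifs with h
  · have hw : 0 < ‖w‖ := hR.trans_lt h
    set t := R / ‖w‖ with ht
    have ht0 : 0 ≤ t := by positivity
    have ht1 : t ≤ 1 := by rw [ht, div_le_one hw]; exact h.le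
    have htw : t * ‖w‖ = R := div_mul_cancel₀ _ hw.ne'
    have hin : inner ℝ w y ≤ ‖w‖ * R :=
      (real_inner_le_norm w y).trans (mul_le_mul_of_nonneg_left hy hw.le)
    refine le_of_sq_le_sq ?_ (norm_nonneg _)
    rw [norm_sub_sq_real, norm_sub_sq_real, norm_smul, Real.norm_of_nonneg ht0,
      real_inner_smul_left]
    -- the difference is `(1 - t) ((1 + t) ‖w‖² - 2 ⟪w, y⟫)`, and `⟪w, y⟫ ≤ ‖w‖ R = t ‖w‖²`
    have e : ‖w‖ * R = t * ‖w‖ ^ 2 := by rw [← htw]; ring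
    have h1 : 0 ≤ (1 - t) * ((1 + t) * ‖w‖ ^ 2 - 2 * inner ℝ w y) := by
      refine mul_nonneg (by linarith) ?_
      have : 0 ≤ (1 - t) * ‖w‖ ^ 2 := mul_nonneg (by linarith) (by positivity)
      nlinarith
    nlinarith
  · exact le_rfl

/-! ### One-step expectations -/

namespace TDCProblem

variable {X A : Type*} [Fintype X] [Fintype A] {d : ℕ} (M : TDCProblem X A d)

/-- Conditional expectation, given the current state `x`, of a function of the action and of the
next state under the behavioral policy. -/
def condMean (x : X) (F : A → X → ℝ) : ℝ :=
  ∑ a, ∑ y, M.behavior.prob x a * M.trans a x y * F a y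

theorem condMean_le_condMean (x : X) {F G : A → X → ℝ}
    (h : ∀ a y, 0 < M.behavior.prob x a → F a y ≤ G a y) : M.condMean x F ≤ M.condMean x G := by
  refine Finset.sum_le_sum fun a _ => Finset.sum_le_sum fun y _ => ?_
  rcases (M.behavior.nonneg x a).eq_or_lt with h0 | h0
  · simp [← h0]
  · exact mul_le_mul_of_nonneg_left (h a y h0) (mul_nonneg h0.le (M.trans_nonneg a x y))

theorem condMean_const (x : X) (c : ℝ) : M.condMean x (fun _ _ => c) = c := by
  simp only [condMean, ← Finset.sum_mul, ← Finset.mul_sum, M.trans_sum, mul_one,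
    M.behavior.sum_one, one_mul]

theorem condMean_add (x : X) (F G : A → X → ℝ) :
    M.condMean x (fun a y => F a y + G a y) = M.condMean x F + M.condMean x G := by
  simp only [condMean, mul_add, Finset.sum_add_distrib]

theorem condMean_const_mul (x : X) (c : ℝ) (F : A → X → ℝ) :
    M.condMean x (fun a y => c * F a y) = c * M.condMean x F := by
  simp only [condMean, Finset.mul_sum]
  exact Finset.sum_congr rfl fun a _ => Finset.sum_congr rfl fun y _ => by ring

theorem condMean_next (x : X) (f : X → ℝ) :
    M.condMean x (fun _ y => f y) = ∑ y, M.chain x y * f y := by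
  simp only [condMean, chain, Matrix.of_apply, Finset.sum_mul]
  exact Finset.sum_comm

theorem abs_condMean_le (x : X) {F : A → X → ℝ} {B : ℝ}
    (h : ∀ a y, 0 < M.behavior.prob x a → |F a y| ≤ B) : |M.condMean x F| ≤ B := by
  rw [abs_le]
  constructor
  · rw [← M.condMean_const x (-B)]
    exact M.condMean_le_condMean x fun a y ha => (abs_le.mp (h a y ha)).1
  · rw [← M.condMean_const x B]
    exact M.condMean_le_condMean x fun a y ha => (abs_le.mp (h a y ha)).2

theorem abs_condMean_sub_le (x : X) {F G : A → X → ℝ} {B : ℝ}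
    (h : ∀ a y, 0 < M.behavior.prob x a → |F a y - G a y| ≤ B) :
    |M.condMean x F - M.condMean x G| ≤ B := by
  have : M.condMean x F - M.condMean x G = M.condMean x (fun a y => F a y - G a y) := by
    simp only [condMean, mul_sub, Finset.sum_sub_distrib]
  rw [this]
  exact M.abs_condMean_le x h

/-- Averaging the conditional means of `⟪v, G⟫` over the steady state gives the inner product
with the stationary mean of `G`. -/
theorem sum_mu_mul_condMean_inner (v : Vec d) (G : X → A → X → Vec d) :
    ∑ x, M.mu x * M.condMean x (fun a y => inner ℝ v (G x a y))
      = inner ℝ v (∑ x, ∑ a, ∑ y, M.transWeight x a y • G x a y) := by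
  simp only [inner_sum, real_inner_smul_right, condMean, Finset.mul_sum, transWeight]
  refine Finset.sum_congr rfl fun x _ => Finset.sum_congr rfl fun a _ =>
    Finset.sum_congr rfl fun y _ => by ring

theorem weight_nonneg (x : X) (a : A) : 0 ≤ M.weight x a :=
  div_nonneg (M.target.nonneg x a) (M.behavior.nonneg x a)

/-! ### The mean dynamics -/

theorem matA_apply (w : Vec d) : Matrix.toEuclideanLin M.matA w =
    ∑ x, ∑ a, ∑ y, M.transWeight x a y •
      ((M.weight x a * inner ℝ (M.γ • M.φ y - M.φ x) w) • M.φ x) := by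
  simp only [matA, map_sum, LinearMap.sum_apply, map_smul, LinearMap.smul_apply,
    toEuclideanLin_vecMulVec, smul_smul, mul_assoc]

theorem matA_transpose_apply (w : Vec d) : Matrix.toEuclideanLin M.matAᵀ w =
    ∑ x, ∑ a, ∑ y, M.transWeight x a y •
      ((M.weight x a * inner ℝ (M.φ x) w) • (M.γ • M.φ y - M.φ x)) := by
  simp only [matA, Matrix.transpose_sum, Matrix.transpose_smul, Matrix.transpose_vecMulVec,
    map_sum, LinearMap.sum_apply, map_smul, LinearMap.smul_apply,
    toEuclideanLin_vecMulVec, smul_smul, mul_assoc]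

theorem matC_apply (w : Vec d) : Matrix.toEuclideanLin M.matC w =
    ∑ x, ∑ a, ∑ y, M.transWeight x a y •
      (-((M.weight x a * inner ℝ (M.φ x) w) • M.φ x)) := by
  simp only [matC, map_sum, map_neg, LinearMap.neg_apply, LinearMap.sum_apply, map_smul,
    LinearMap.smul_apply, toEuclideanLin_vecMulVec, smul_smul, mul_assoc, smul_neg,
    Finset.sum_neg_distrib]

theorem matC_transpose : M.matCᵀ = M.matC := by
  simp [matC, Matrix.transpose_sum, Matrix.transpose_smul, Matrix.transpose_vecMulVec]

theorem matC_isHermitian : M.matC.IsHermitian := by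
  rw [Matrix.IsHermitian, Matrix.conjTranspose_eq_transpose_of_trivial, M.matC_transpose]

/-- Update direction of the auxiliary parameter `u` for the transition `(x, a, y)`. -/
def dirU (x : X) (a : A) (y : X) (w u : Vec d) : Vec d :=
  (M.weight x a * M.tdError x a y w) • M.φ x - (M.weight x a * inner ℝ (M.φ x) u) • M.φ x

/-- Update direction of the main parameter `w` for the transition `(x, a, y)`, up to terms of
second order in the step size. -/
def dirW (x : X) (a : A) (y : X) (w u : Vec d) : Vec d :=
  (M.weight x a * M.tdError x a y w) • M.φ x
    - (M.weight x a * M.γ * inner ℝ (M.φ x) u) • M.φ y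

theorem tdError_eq (x : X) (a : A) (y : X) (w : Vec d) :
    M.tdError x a y w = M.reward x a + inner ℝ (M.γ • M.φ y - M.φ x) w := by
  rw [tdError, inner_sub_left, real_inner_smul_left]
  ring

theorem matC_uStar (hC : IsUnit M.matC.det) (w : Vec d) :
    Matrix.toEuclideanLin M.matC (M.uStar w)
      = -(M.vecb + Matrix.toEuclideanLin M.matA w) := by
  rw [uStar, map_neg, toEuclideanLin_mul_inv_apply hC]

theorem matA_wStar (hA : IsUnit M.matA.det) :
    Matrix.toEuclideanLin M.matA M.wStar = -M.vecb := by
  rw [wStar, map_neg, toEuclideanLin_mul_inv_apply hA]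

/-- The steady-state mean of the direction of `u` is `C` applied to the tracking error. -/
theorem mean_dirU (hC : IsUnit M.matC.det) (w u : Vec d) :
    ∑ x, ∑ a, ∑ y, M.transWeight x a y • M.dirU x a y w u
      = Matrix.toEuclideanLin M.matC (u - M.uStar w) := by
  rw [map_sub, M.matC_uStar hC, sub_neg_eq_add, M.matC_apply, M.matA_apply, vecb]
  simp only [← Finset.sum_add_distrib]
  refine Finset.sum_congr rfl fun x _ => Finset.sum_congr rfl fun a _ =>
    Finset.sum_congr rfl fun y _ => ?_
  rw [dirU, M.tdError_eq]
  module

theorem uStar_eq (hA : IsUnit M.matA.det) (w : Vec d) :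
    M.uStar w
      = -(Matrix.toEuclideanLin M.matC⁻¹ (Matrix.toEuclideanLin M.matA (w - M.wStar))) := by
  rw [uStar, map_sub (Matrix.toEuclideanLin M.matA), M.matA_wStar hA, sub_neg_eq_add, add_comm]

/-- Along `u = u^*(w)` the steady-state mean of the direction of `w` is `Aᵀ C⁻¹ A (w - w_*)`. -/
theorem mean_dirW (hA : IsUnit M.matA.det) (hC : IsUnit M.matC.det) (w : Vec d) :
    ∑ x, ∑ a, ∑ y, M.transWeight x a y • M.dirW x a y w (M.uStar w)
      = Matrix.toEuclideanLin (M.matAᵀ * M.matC⁻¹ * M.matA) (w - M.wStar) := by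
  have h1 : Matrix.toEuclideanLin (M.matAᵀ * M.matC⁻¹ * M.matA) (w - M.wStar)
      = (M.vecb + Matrix.toEuclideanLin M.matA w
          + Matrix.toEuclideanLin M.matC (M.uStar w))
        - Matrix.toEuclideanLin M.matAᵀ (M.uStar w) := by
    rw [M.matC_uStar hC, add_neg_cancel, zero_sub, M.uStar_eq hA, map_neg, neg_neg,
      toEuclideanLin_mul_apply, toEuclideanLin_mul_apply]
  rw [h1, M.matC_apply, M.matA_apply, M.matA_transpose_apply, vecb]
  simp only [← Finset.sum_add_distrib, ← Finset.sum_sub_distrib]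
  refine Finset.sum_congr rfl fun x _ => Finset.sum_congr rfl fun a _ =>
    Finset.sum_congr rfl fun y _ => ?_
  rw [dirW, M.tdError_eq]
  module

end TDCProblem

/-! ### Consequences of the standing assumptions -/

namespace TDCProblem

variable {X A : Type*} [Fintype X] [Fintype A] {d : ℕ}

/-- The standing assumptions of the finite-time analysis, except for the mixing of the state chain,
of which only the stationarity of `M.mu` is kept. -/
structure Standing (M : TDCProblem X A d) (ρmax rmax lamc lamu lamw Rw Ru : ℝ) : Prop where
  ρmax_pos : 0 < ρmax
  rmax_pos : 0 < rmax
  Rw_pos : 0 < Rw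
  Ru_pos : 0 < Ru
  stationary : IsStationaryDist M.chain M.mu
  reward : M.BoundedReward rmax
  features : M.NormalizedFeatures
  weight : M.BoundedWeight ρmax
  solvable : M.Solvable lamc lamu lamw
  wStar : ‖M.wStar‖ ≤ Rw
  radius : 2 * ρmax * (M.γ + 1) * Rw / lamc ≤ Ru

/-- A bound on the increments per unit of step size (for `cα ≤ 1`), on the directions `dirU` and
`dirW`, and on the second-order coefficients of the increments. -/
def incBound (ρmax rmax Rw Ru : ℝ) : ℝ := ρmax * (rmax + 2 * Rw + Ru) * (1 + ρmax)

/-- A Lipschitz constant of `w ↦ u^*(w)`. -/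
def lipU (ρmax lamc : ℝ) : ℝ := 2 * ρmax / lamc

variable {M : TDCProblem X A d} {ρmax rmax lamc lamu lamw Rw Ru : ℝ}

namespace Standing

/-- A steady-state mean is bounded by any bound valid along transitions that can occur. -/
theorem norm_mean_le (h : M.Standing ρmax rmax lamc lamu lamw Rw Ru) {G : X → A → X → Vec d}
    {B : ℝ} (hG : ∀ x a y, 0 < M.behavior.prob x a → ‖G x a y‖ ≤ B) :
    ‖∑ x, ∑ a, ∑ y, M.transWeight x a y • G x a y‖ ≤ B := by
  set z := ∑ x, ∑ a, ∑ y, M.transWeight x a y • G x a y with hz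
  have h1 : ‖z‖ ^ 2 ≤ ‖z‖ * B := by
    rw [← real_inner_self_eq_norm_sq]
    nth_rewrite 2 [hz]
    rw [← M.sum_mu_mul_condMean_inner]
    calc ∑ x, M.mu x * M.condMean x (fun a y => inner ℝ z (G x a y))
        ≤ ∑ x, M.mu x * (‖z‖ * B) := by
          refine Finset.sum_le_sum fun x _ =>
            mul_le_mul_of_nonneg_left ?_ (h.stationary.nonneg x)
          rw [← M.condMean_const x (‖z‖ * B)]
          exact M.condMean_le_condMean x fun a y ha => (real_inner_le_norm _ _).trans
            (mul_le_mul_of_nonneg_left (hG x a y ha) (norm_nonneg _))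
      _ = ‖z‖ * B := by rw [← Finset.sum_mul, h.stationary.sum_one, one_mul]
  rcases (norm_nonneg z).eq_or_lt with h0 | h0
  · obtain ⟨x, hx⟩ : ∃ x, M.mu x ≠ 0 := by
      by_contra! hc
      simpa [hc] using h.stationary.sum_one
    obtain ⟨a, ha⟩ : ∃ a, M.behavior.prob x a ≠ 0 := by
      by_contra! hc
      simpa [hc] using M.behavior.sum_one x
    rw [← h0]
    exact (norm_nonneg _).trans (hG x a x (lt_of_le_of_ne (M.behavior.nonneg x a) ha.symm))
  · nlinarith

theorem norm_feature_diff_le (h : M.Standing ρmax rmax lamc lamu lamw Rw Ru) (x y : X) :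
    ‖M.γ • M.φ y - M.φ x‖ ≤ M.γ + 1 := by
  refine (norm_sub_le _ _).trans (add_le_add ?_ (h.features x))
  rw [norm_smul, Real.norm_of_nonneg M.γ_pos.le]
  exact mul_le_of_le_one_right M.γ_pos.le (h.features y)

theorem norm_matA_le (h : M.Standing ρmax rmax lamc lamu lamw Rw Ru) (w : Vec d) :
    ‖Matrix.toEuclideanLin M.matA w‖ ≤ ρmax * (M.γ + 1) * ‖w‖ := by
  rw [M.matA_apply]
  refine h.norm_mean_le fun x a y ha => ?_
  have hγ := M.γ_pos
  have hρ := h.ρmax_pos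
  rw [norm_smul, norm_mul, Real.norm_of_nonneg (M.weight_nonneg x a)]
  have h1 : ‖(inner ℝ (M.γ • M.φ y - M.φ x) w : ℝ)‖ ≤ (M.γ + 1) * ‖w‖ :=
    (norm_inner_le_norm _ _).trans
      (mul_le_mul_of_nonneg_right (h.norm_feature_diff_le x y) (norm_nonneg _))
  calc M.weight x a * ‖(inner ℝ (M.γ • M.φ y - M.φ x) w : ℝ)‖ * ‖M.φ x‖
      ≤ ρmax * ((M.γ + 1) * ‖w‖) * 1 := by
        gcongr
        · exact h.weight x a ha
        · exact h.features x
    _ = _ := by ring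

theorem inner_matC_le (h : M.Standing ρmax rmax lamc lamu lamw Rw Ru) (v : Vec d) :
    2 * inner ℝ v (Matrix.toEuclideanLin M.matC v) ≤ lamu * ‖v‖ ^ 2 := by
  have hH : ((2 : ℝ) • M.matC).IsHermitian := by
    rw [Matrix.IsHermitian, Matrix.conjTranspose_smul, M.matC_isHermitian.eq, star_trivial]
  simpa [real_inner_smul_right] using
    inner_toEuclideanLin_le_of_eigenvalue_le hH h.solvable.lamu_ge v

theorem inner_matACA_le (h : M.Standing ρmax rmax lamc lamu lamw Rw Ru) (v : Vec d) :
    2 * inner ℝ v (Matrix.toEuclideanLin (M.matAᵀ * M.matC⁻¹ * M.matA) v) ≤ lamw * ‖v‖ ^ 2 := by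
  have hH : ((2 : ℝ) • (M.matAᵀ * M.matC⁻¹ * M.matA)).IsHermitian := by
    rw [Matrix.IsHermitian, Matrix.conjTranspose_eq_transpose_of_trivial]
    simp [Matrix.transpose_smul, Matrix.transpose_mul, Matrix.transpose_nonsing_inv,
      M.matC_transpose, Matrix.mul_assoc]
  simpa [real_inner_smul_right] using
    inner_toEuclideanLin_le_of_eigenvalue_le hH h.solvable.lamw_ge v

/-- The eigenvalues of `C` are negative, so that the smallest absolute eigenvalue controls the
quadratic form. -/
theorem inner_matC_le_neg_lamc (h : M.Standing ρmax rmax lamc lamu lamw Rw Ru) (v : Vec d) :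
    inner ℝ v (Matrix.toEuclideanLin M.matC v) ≤ -lamc * ‖v‖ ^ 2 := by
  refine inner_toEuclideanLin_le_of_eigenvalue_le M.matC_isHermitian (fun s hs => ?_) v
  have hmin := h.solvable.lamc_min.2 ⟨s, hs, rfl⟩
  obtain ⟨z, hz, hz0⟩ := hs.exists_hasEigenvector
  rw [Module.End.mem_eigenspace_iff] at hz
  have h1 : Matrix.toEuclideanLin M.matC (WithLp.toLp 2 z) = s • WithLp.toLp 2 z := by
    rw [Matrix.toLpLin_toLp, hz, WithLp.toLp_smul]
  have h2 := h.inner_matC_le (WithLp.toLp 2 z)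
  rw [h1, real_inner_smul_right, real_inner_self_eq_norm_sq] at h2
  have h3 : 0 < ‖(WithLp.toLp 2 z : Vec d)‖ := by
    rw [norm_pos_iff]
    intro h0
    exact hz0 (by simpa using congrArg WithLp.ofLp h0)
  have hs0 : s < 0 := by
    have := h.solvable.lamu_neg
    have h4 : 0 < ‖(WithLp.toLp 2 z : Vec d)‖ ^ 2 := by positivity
    nlinarith
  rw [abs_of_neg hs0] at hmin
  linarith

theorem lamc_mul_norm_inv_le (h : M.Standing ρmax rmax lamc lamu lamw Rw Ru) (y : Vec d) :
    lamc * ‖Matrix.toEuclideanLin M.matC⁻¹ y‖ ≤ ‖y‖ := by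
  set z := Matrix.toEuclideanLin M.matC⁻¹ y with hz
  have h1 := h.inner_matC_le_neg_lamc z
  rw [hz, toEuclideanLin_mul_inv_apply h.solvable.C_nonsing, ← hz] at h1
  have h2 := neg_le_of_abs_le (abs_real_inner_le_norm z y)
  rcases (norm_nonneg z).eq_or_lt with h0 | h0
  · rw [← h0]; simp
  · nlinarith

theorem norm_uStar_sub_le (h : M.Standing ρmax rmax lamc lamu lamw Rw Ru) (w w' : Vec d) :
    ‖M.uStar w - M.uStar w'‖ ≤ lipU ρmax lamc * ‖w - w'‖ := by
  have hc := h.solvable.lamc_pos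
  have e : M.uStar w - M.uStar w'
      = -(Matrix.toEuclideanLin M.matC⁻¹ (Matrix.toEuclideanLin M.matA (w - w'))) := by
    simp only [uStar, map_add, map_sub]
    abel
  rw [e, norm_neg, lipU, div_mul_eq_mul_div, le_div_iff₀ hc, mul_comm]
  refine (h.lamc_mul_norm_inv_le _).trans ((h.norm_matA_le _).trans ?_)
  have := M.γ_lt_one
  have := h.ρmax_pos
  have h1 : ρmax * (M.γ + 1) ≤ 2 * ρmax := by nlinarith
  exact mul_le_mul_of_nonneg_right h1 (norm_nonneg _)

/-- By the choice of the radius `Ru`, the ball for `u` contains `u^*(w)` for `w` in its ball. -/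
theorem norm_uStar_le (h : M.Standing ρmax rmax lamc lamu lamw Rw Ru) {w : Vec d}
    (hw : ‖w‖ ≤ Rw) : ‖M.uStar w‖ ≤ Ru := by
  have hc := h.solvable.lamc_pos
  have hγ := M.γ_pos
  have hρ := h.ρmax_pos
  refine le_trans ?_ h.radius
  rw [le_div_iff₀ hc, mul_comm, M.uStar_eq h.solvable.A_nonsing, norm_neg]
  refine (h.lamc_mul_norm_inv_le _).trans ((h.norm_matA_le _).trans ?_)
  have h1 : ‖w - M.wStar‖ ≤ 2 * Rw := (norm_sub_le _ _).trans (by linarith [h.wStar])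
  calc ρmax * (M.γ + 1) * ‖w - M.wStar‖ ≤ ρmax * (M.γ + 1) * (2 * Rw) := by gcongr
    _ = _ := by ring

theorem lipU_nonneg (h : M.Standing ρmax rmax lamc lamu lamw Rw Ru) : 0 ≤ lipU ρmax lamc := by
  have := h.solvable.lamc_pos
  have := h.ρmax_pos
  unfold lipU
  positivity

theorem incBound_pos (h : M.Standing ρmax rmax lamc lamu lamw Rw Ru) :
    0 < incBound ρmax rmax Rw Ru := by
  have := h.ρmax_pos
  have := h.rmax_pos
  have := h.Rw_pos
  have := h.Ru_pos
  unfold incBound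
  positivity

/-! ### Sizes of the increments -/

theorem abs_tdError_le (h : M.Standing ρmax rmax lamc lamu lamw Rw Ru) {x : X} {a : A} (y : X)
    (ha : 0 < M.behavior.prob x a) {w : Vec d} (hw : ‖w‖ ≤ Rw) :
    |M.tdError x a y w| ≤ rmax + 2 * Rw := by
  rw [M.tdError_eq]
  refine (abs_add_le _ _).trans (add_le_add (h.reward x a ha) ?_)
  refine (abs_real_inner_le_norm _ _).trans ?_
  have h1 := h.norm_feature_diff_le x y
  have h2 := M.γ_lt_one
  exact mul_le_mul (by linarith) hw (norm_nonneg _) (by norm_num)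

theorem abs_tdError_sub_le (h : M.Standing ρmax rmax lamc lamu lamw Rw Ru) (x : X) (a : A) (y : X)
    (w w' : Vec d) : |M.tdError x a y w - M.tdError x a y w'| ≤ 2 * ‖w - w'‖ := by
  rw [M.tdError_eq, M.tdError_eq, add_sub_add_left_eq_sub, ← inner_sub_right]
  refine (abs_real_inner_le_norm _ _).trans ?_
  have h1 := h.norm_feature_diff_le x y
  have h2 := M.γ_lt_one
  exact mul_le_mul_of_nonneg_right (by linarith) (norm_nonneg _)

theorem abs_inner_feature_le (h : M.Standing ρmax rmax lamc lamu lamw Rw Ru) (x : X) (u : Vec d) :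
    |(inner ℝ (M.φ x) u : ℝ)| ≤ ‖u‖ :=
  (abs_real_inner_le_norm _ _).trans (mul_le_of_le_one_left (norm_nonneg _) (h.features x))

theorem norm_smul_feature_le (h : M.Standing ρmax rmax lamc lamu lamw Rw Ru) (x : X) {t B : ℝ}
    (ht : |t| ≤ B) : ‖t • M.φ x‖ ≤ B := by
  rw [norm_smul]
  exact (mul_le_of_le_one_right (norm_nonneg _) (h.features x)).trans ht

theorem abs_weight_mul_le (h : M.Standing ρmax rmax lamc lamu lamw Rw Ru) {x : X} {a : A}
    (ha : 0 < M.behavior.prob x a) {t B : ℝ} (ht : |t| ≤ B) :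
    |M.weight x a * t| ≤ ρmax * B := by
  rw [abs_mul, abs_of_nonneg (M.weight_nonneg x a)]
  exact mul_le_mul (h.weight x a ha) ht (abs_nonneg _) h.ρmax_pos.le

theorem norm_dirU_sub_le (h : M.Standing ρmax rmax lamc lamu lamw Rw Ru) {x : X} {a : A} (y : X)
    (ha : 0 < M.behavior.prob x a) (w u w' u' : Vec d) :
    ‖M.dirU x a y w u - M.dirU x a y w' u'‖ ≤ ρmax * (2 * ‖w - w'‖ + ‖u - u'‖) := by
  have e : M.dirU x a y w u - M.dirU x a y w' u'
      = (M.weight x a * ((M.tdError x a y w - M.tdError x a y w') - inner ℝ (M.φ x) (u - u')))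
          • M.φ x := by
    rw [dirU, dirU, inner_sub_right]
    module
  rw [e]
  refine h.norm_smul_feature_le x (h.abs_weight_mul_le ha ((abs_sub _ _).trans
    (add_le_add (h.abs_tdError_sub_le x a y w w') (h.abs_inner_feature_le x _))))

theorem norm_dirW_sub_le (h : M.Standing ρmax rmax lamc lamu lamw Rw Ru) {x : X} {a : A} (y : X)
    (ha : 0 < M.behavior.prob x a) (w u w' u' : Vec d) :
    ‖M.dirW x a y w u - M.dirW x a y w' u'‖ ≤ ρmax * (2 * ‖w - w'‖ + ‖u - u'‖) := by
  have e : M.dirW x a y w u - M.dirW x a y w' u'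
      = (M.weight x a * (M.tdError x a y w - M.tdError x a y w')) • M.φ x
        - (M.weight x a * (M.γ * inner ℝ (M.φ x) (u - u'))) • M.φ y := by
    rw [dirW, dirW, inner_sub_right]
    module
  rw [e, mul_add]
  refine (norm_sub_le _ _).trans (add_le_add
    (h.norm_smul_feature_le x (h.abs_weight_mul_le ha (h.abs_tdError_sub_le x a y w w')))
    (h.norm_smul_feature_le y (h.abs_weight_mul_le ha ?_)))
  rw [abs_mul, abs_of_pos M.γ_pos]
  exact (mul_le_of_le_one_left (abs_nonneg _) M.γ_lt_one.le).trans (h.abs_inner_feature_le x _)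

theorem norm_dirU_le' (h : M.Standing ρmax rmax lamc lamu lamw Rw Ru) {x : X} {a : A} (y : X)
    (ha : 0 < M.behavior.prob x a) {w u : Vec d} (hw : ‖w‖ ≤ Rw) (hu : ‖u‖ ≤ Ru) :
    ‖M.dirU x a y w u‖ ≤ ρmax * (rmax + 2 * Rw + Ru) := by
  rw [dirU, mul_add]
  exact (norm_sub_le _ _).trans (add_le_add
    (h.norm_smul_feature_le x (h.abs_weight_mul_le ha (h.abs_tdError_le y ha hw)))
    (h.norm_smul_feature_le x (h.abs_weight_mul_le ha ((h.abs_inner_feature_le x _).trans hu))))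

theorem norm_dirW_le' (h : M.Standing ρmax rmax lamc lamu lamw Rw Ru) {x : X} {a : A} (y : X)
    (ha : 0 < M.behavior.prob x a) {w u : Vec d} (hw : ‖w‖ ≤ Rw) (hu : ‖u‖ ≤ Ru) :
    ‖M.dirW x a y w u‖ ≤ ρmax * (rmax + 2 * Rw + Ru) := by
  rw [dirW, mul_add, mul_assoc (M.weight x a) M.γ]
  refine (norm_sub_le _ _).trans (add_le_add
    (h.norm_smul_feature_le x (h.abs_weight_mul_le ha (h.abs_tdError_le y ha hw)))
    (h.norm_smul_feature_le y (h.abs_weight_mul_le ha ?_)))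
  rw [abs_mul, abs_of_pos M.γ_pos]
  exact (mul_le_of_le_one_left (abs_nonneg _) M.γ_lt_one.le).trans
    ((h.abs_inner_feature_le x _).trans hu)

theorem le_incBound (h : M.Standing ρmax rmax lamc lamu lamw Rw Ru) :
    ρmax * (rmax + 2 * Rw + Ru) ≤ incBound ρmax rmax Rw Ru := by
  have h1 := h.ρmax_pos
  have h2 := h.rmax_pos
  have h3 := h.Rw_pos
  have h4 := h.Ru_pos
  unfold incBound
  exact le_mul_of_one_le_right (by positivity) (by linarith)

theorem norm_dirU_le (h : M.Standing ρmax rmax lamc lamu lamw Rw Ru) {x : X} {a : A} (y : X)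
    (ha : 0 < M.behavior.prob x a) {w u : Vec d} (hw : ‖w‖ ≤ Rw) (hu : ‖u‖ ≤ Ru) :
    ‖M.dirU x a y w u‖ ≤ incBound ρmax rmax Rw Ru :=
  (h.norm_dirU_le' y ha hw hu).trans h.le_incBound

theorem norm_dirW_le (h : M.Standing ρmax rmax lamc lamu lamw Rw Ru) {x : X} {a : A} (y : X)
    (ha : 0 < M.behavior.prob x a) {w u : Vec d} (hw : ‖w‖ ≤ Rw) (hu : ‖u‖ ≤ Ru) :
    ‖M.dirW x a y w u‖ ≤ incBound ρmax rmax Rw Ru :=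
  (h.norm_dirW_le' y ha hw hu).trans h.le_incBound

/-- The implicit step size differs from the nominal one only in second order. -/
theorem adaptStep_bounds (h : M.Standing ρmax rmax lamc lamu lamw Rw Ru) {x : X} {a : A}
    (ha : 0 < M.behavior.prob x a) {c : ℝ} (hc : 0 < c) :
    0 ≤ M.adaptStep c x a ∧ M.adaptStep c x a ≤ c ∧ |M.adaptStep c x a - c| ≤ c ^ 2 * ρmax := by
  have hw := M.weight_nonneg x a
  set t := c * M.weight x a * ‖M.φ x‖ ^ 2 with ht
  have ht0 : 0 ≤ t := by positivity
  have ht1 : t ≤ c * ρmax := by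
    calc t ≤ c * ρmax * 1 := by
          rw [ht]
          gcongr
          · exact mul_nonneg hc.le h.ρmax_pos.le
          · exact h.weight x a ha
          · exact pow_le_one₀ (norm_nonneg _) (h.features x)
      _ = _ := mul_one _
  have e : M.adaptStep c x a - c = -(c * t / (1 + t)) := by
    rw [adaptStep, ← ht]
    field_simp
    ring
  have h1 : c * t / (1 + t) ≤ c * t := div_le_self (by positivity) (by linarith)
  have h2 : 0 ≤ c * t / (1 + t) := by positivity
  refine ⟨by rw [adaptStep, ← ht]; positivity, by linarith, ?_⟩
  rw [e, abs_neg, abs_of_nonneg h2]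
  nlinarith

/-- One update is the projection of a move along `cα • dirW` and `cβ • dirU`, up to errors of second
order in the step sizes. -/
theorem exists_step_eq (h : M.Standing ρmax rmax lamc lamu lamw Rw Ru) {x : X} {a : A} (y : X)
    (ha : 0 < M.behavior.prob x a) {cα cβ : ℝ} (hα : 0 < cα) (hα1 : cα ≤ 1) (hβ : 0 < cβ)
    {w u : Vec d} (hw : ‖w‖ ≤ Rw) (hu : ‖u‖ ≤ Ru) :
    ∃ p q : Vec d,
      M.step cα cβ Rw Ru x a y (w, u) = (ballProj Rw (w + p), ballProj Ru (u + q)) ∧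
      ‖p‖ ≤ cα * incBound ρmax rmax Rw Ru ∧
      ‖p - cα • M.dirW x a y w u‖ ≤ cα ^ 2 * incBound ρmax rmax Rw Ru ∧
      ‖q‖ ≤ cβ * incBound ρmax rmax Rw Ru ∧
      ‖q - cβ • M.dirU x a y w u‖ ≤ cβ ^ 2 * incBound ρmax rmax Rw Ru := by
  obtain ⟨a0, a1, a2⟩ := h.adaptStep_bounds ha hα
  obtain ⟨b0, b1, b2⟩ := h.adaptStep_bounds ha hβ
  have hρ := h.ρmax_pos
  have hr := h.rmax_pos
  have hRw := h.Rw_pos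
  have hRu := h.Ru_pos
  set α' := M.adaptStep cα x a with hα'
  set β' := M.adaptStep cβ x a with hβ'
  set G₀ := ρmax * (rmax + 2 * Rw + Ru) with hG₀
  have hG₀p : 0 < G₀ := by positivity
  have hG : incBound ρmax rmax Rw Ru = G₀ + ρmax * G₀ := by rw [incBound]; ring
  have hdU := h.norm_dirU_le' y ha hw hu
  have hdW := h.norm_dirW_le' y ha hw hu
  rw [← hG₀] at hdU hdW
  set p : Vec d := (α' * M.weight x a * M.tdError x a y w) • M.φ x
      - (cα * M.weight x a * M.γ * inner ℝ (M.φ x) u) •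
        (M.φ y - (α' * M.weight x a * inner ℝ (M.φ x) (M.φ y)) • M.φ x) with hp
  have hpd : ‖p - cα • M.dirW x a y w u‖ ≤ cα ^ 2 * (ρmax * G₀) := by
    have e : p - cα • M.dirW x a y w u
        = ((α' - cα) * (M.weight x a * M.tdError x a y w)) • M.φ x
          + (α' * (cα * ((M.weight x a * (M.γ * inner ℝ (M.φ x) u)) *
            (M.weight x a * inner ℝ (M.φ x) (M.φ y))))) • M.φ x := by
      rw [hp, dirW]
      module
    rw [e]
    have i1 : |(α' - cα) * (M.weight x a * M.tdError x a y w)|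
        ≤ (cα ^ 2 * ρmax) * (ρmax * (rmax + 2 * Rw)) := by
      rw [abs_mul]
      exact mul_le_mul a2 (h.abs_weight_mul_le ha (h.abs_tdError_le y ha hw)) (abs_nonneg _)
        (by positivity)
    have i2 : |M.weight x a * (M.γ * inner ℝ (M.φ x) u)| ≤ ρmax * Ru := by
      refine h.abs_weight_mul_le ha ?_
      rw [abs_mul, abs_of_pos M.γ_pos]
      exact (mul_le_of_le_one_left (abs_nonneg _) M.γ_lt_one.le).trans
        ((h.abs_inner_feature_le x _).trans hu)
    have i3 : |M.weight x a * (inner ℝ (M.φ x) (M.φ y) : ℝ)| ≤ ρmax * 1 :=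
      h.abs_weight_mul_le ha ((h.abs_inner_feature_le x _).trans (h.features y))
    have i4 : |α' * (cα * ((M.weight x a * (M.γ * inner ℝ (M.φ x) u)) *
            (M.weight x a * inner ℝ (M.φ x) (M.φ y))))|
        ≤ cα * (cα * ((ρmax * Ru) * (ρmax * 1))) := by
      rw [abs_mul, abs_mul, abs_mul (M.weight x a * (M.γ * inner ℝ (M.φ x) u)),
        abs_of_nonneg a0, abs_of_pos hα]
      gcongr
    refine (norm_add_le _ _).trans ((add_le_add (h.norm_smul_feature_le x i1)
      (h.norm_smul_feature_le x i4)).trans (le_of_eq ?_))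
    rw [hG₀]
    ring
  refine ⟨p, β' • M.dirU x a y w u, ?_, ?_, ?_, ?_, ?_⟩
  · rw [step, Prod.mk.injEq]
    constructor
    · congr 1
      rw [hp, add_sub_assoc]
    · congr 1
      rw [dirU]
      module
  · have : p = cα • M.dirW x a y w u + (p - cα • M.dirW x a y w u) := by abel
    rw [this, hG]
    refine (norm_add_le _ _).trans ?_
    rw [norm_smul, Real.norm_of_nonneg hα.le, mul_add]
    refine add_le_add (mul_le_mul_of_nonneg_left hdW hα.le) (hpd.trans ?_)
    exact mul_le_mul_of_nonneg_right (by nlinarith) (by positivity)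
  · refine hpd.trans (mul_le_mul_of_nonneg_left ?_ (by positivity))
    rw [hG]
    linarith
  · rw [norm_smul, Real.norm_of_nonneg b0]
    exact mul_le_mul b1 (h.norm_dirU_le y ha hw hu) (norm_nonneg _) hβ.le
  · rw [← sub_smul, norm_smul, Real.norm_eq_abs]
    refine (mul_le_mul b2 hdU (norm_nonneg _) (by positivity)).trans ?_
    rw [mul_assoc]
    refine mul_le_mul_of_nonneg_left ?_ (by positivity)
    rw [hG]
    linarith

end Standing
end TDCProblem

/-! ### The transfer operator of the joint chain of iterates and states -/

namespace TDCProblem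

variable {X A : Type*} [Fintype X] [Fintype A] {d : ℕ} (M : TDCProblem X A d) {Θ : Type*}

/-- The transition operator of the Markov chain `(θ, x)` in which the parameter is updated by the
map `F` along the observed transition: it sends `f` to the conditional mean of `f` one step
later. -/
def transfer (F : X → A → X → Θ → Θ) (f : Θ → X → ℝ) (θ : Θ) (x : X) : ℝ :=
  M.condMean x fun a y => f (F x a y θ) y

/-- Expectation of `f` at time `n` when the initial state is stationary and the initial parameter
is `θ₀`. -/
def expect (F : X → A → X → Θ → Θ) (θ₀ : Θ) (n : ℕ) (f : Θ → X → ℝ) : ℝ :=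
  ∑ x, M.mu x * (M.transfer F)^[n] f θ₀ x

/-- The set `S` of parameters is preserved by all updates along transitions that can occur. -/
def IsInvariant (F : X → A → X → Θ → Θ) (S : Set Θ) : Prop :=
  ∀ θ ∈ S, ∀ x a y, 0 < M.behavior.prob x a → F x a y θ ∈ S

variable {M} {F : X → A → X → Θ → Θ} {S : Set Θ} {θ₀ : Θ}

theorem expect_succ (n : ℕ) (f : Θ → X → ℝ) :
    M.expect F θ₀ (n + 1) f = M.expect F θ₀ n (M.transfer F f) := by
  simp only [expect, Function.iterate_succ_apply]

theorem expect_add_index (n k : ℕ) (f : Θ → X → ℝ) :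
    M.expect F θ₀ (n + k) f = M.expect F θ₀ n ((M.transfer F)^[k] f) := by
  simp only [expect, Function.iterate_add_apply]

theorem expect_add (n : ℕ) (f g : Θ → X → ℝ) :
    M.expect F θ₀ n (fun θ x => f θ x + g θ x) = M.expect F θ₀ n f + M.expect F θ₀ n g := by
  induction n generalizing f g with
  | zero => simp [expect, mul_add, Finset.sum_add_distrib]
  | succ n ih =>
    rw [expect_succ, expect_succ, expect_succ, ← ih]
    congr 1
    funext θ x
    exact M.condMean_add x _ _

theorem expect_const_mul (n : ℕ) (c : ℝ) (f : Θ → X → ℝ) :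
    M.expect F θ₀ n (fun θ x => c * f θ x) = c * M.expect F θ₀ n f := by
  induction n generalizing f with
  | zero =>
    simp only [expect, Function.iterate_zero, id, Finset.mul_sum]
    exact Finset.sum_congr rfl fun x _ => by ring
  | succ n ih =>
    rw [expect_succ, expect_succ, ← ih]
    congr 1
    funext θ x
    exact M.condMean_const_mul x _ _

theorem expect_const (hst : IsStationaryDist M.chain M.mu) (n : ℕ) (c : ℝ) :
    M.expect F θ₀ n (fun _ _ => c) = c := by
  induction n with
  | zero => simp [expect, ← Finset.sum_mul, hst.sum_one]
  | succ n ih =>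
    rw [expect_succ]
    have : M.transfer F (fun _ _ => c) = fun _ _ => c := by
      funext θ x
      exact M.condMean_const x c
    rw [this, ih]

theorem expect_le_expect (hst : IsStationaryDist M.chain M.mu) (hS : M.IsInvariant F S)
    (hθ : θ₀ ∈ S) (n : ℕ) {f g : Θ → X → ℝ} (h : ∀ θ ∈ S, ∀ x, f θ x ≤ g θ x) :
    M.expect F θ₀ n f ≤ M.expect F θ₀ n g := by
  induction n generalizing f g with
  | zero =>
    exact Finset.sum_le_sum fun x _ => mul_le_mul_of_nonneg_left (h _ hθ x) (hst.nonneg x)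
  | succ n ih =>
    rw [expect_succ, expect_succ]
    exact ih fun θ hθ' x => M.condMean_le_condMean x fun a y ha => h _ (hS θ hθ' x a y ha) y

theorem sq_expect_le (hst : IsStationaryDist M.chain M.mu) (hS : M.IsInvariant F S)
    (hθ : θ₀ ∈ S) (n : ℕ) (f : Θ → X → ℝ) :
    M.expect F θ₀ n f ^ 2 ≤ M.expect F θ₀ n (fun θ x => f θ x ^ 2) := by
  set t := M.expect F θ₀ n f with ht
  have h1 : M.expect F θ₀ n (fun θ x => 2 * t * f θ x + (-(t ^ 2)))
      ≤ M.expect F θ₀ n (fun θ x => f θ x ^ 2) :=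
    expect_le_expect hst hS hθ n fun θ _ x => by nlinarith [sq_nonneg (f θ x - t)]
  rw [expect_add, expect_const_mul, expect_const hst, ← ht] at h1
  nlinarith

/-! ### Mixing along the slowly varying iterates -/

theorem chain_nonneg (x y : X) : 0 ≤ M.chain x y :=
  Finset.sum_nonneg fun a _ => mul_nonneg (M.behavior.nonneg x a) (M.trans_nonneg a x y)

theorem sum_mul_sub_le_tvDist (p q f : X → ℝ) {B : ℝ} (hf : ∀ x, |f x| ≤ B) :
    ∑ x, p x * f x - ∑ x, q x * f x ≤ 2 * B * tvDist p q := by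
  rw [tvDist, ← Finset.sum_sub_distrib, Finset.mul_sum, Finset.mul_sum]
  refine Finset.sum_le_sum fun x _ => ?_
  have h1 : (p x - q x) * f x ≤ |p x - q x| * B :=
    (le_abs_self _).trans (by
      rw [abs_mul]
      exact mul_le_mul_of_nonneg_left (hf x) (abs_nonneg _))
  linarith

section Mixing

variable [DecidableEq X]

theorem chain_pow_nonneg (k : ℕ) (x y : X) : 0 ≤ (M.chain ^ k) x y := by
  induction k generalizing x with
  | zero => rw [pow_zero, Matrix.one_apply]; split_ifs <;> norm_num
  | succ k ih =>
    rw [pow_succ', Matrix.mul_apply]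
    exact Finset.sum_nonneg fun z _ => mul_nonneg (chain_nonneg x z) (ih z)

theorem sum_chain_pow (k : ℕ) (x : X) : ∑ y, (M.chain ^ k) x y = 1 := by
  induction k generalizing x with
  | zero => simp [Matrix.one_apply]
  | succ k ih =>
    simp only [pow_succ', Matrix.mul_apply]
    rw [Finset.sum_comm]
    simp only [← Finset.mul_sum, ih, mul_one]
    have := M.condMean_next x (fun _ => 1)
    rw [M.condMean_const] at this
    simpa using this.symm

theorem sum_mu_mul_chain_pow (hst : IsStationaryDist M.chain M.mu) (k : ℕ) (y : X) :
    ∑ x, M.mu x * (M.chain ^ k) x y = M.mu y := by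
  induction k generalizing y with
  | zero => simp [Matrix.one_apply]
  | succ k ih =>
    simp only [pow_succ, Matrix.mul_apply, Finset.mul_sum]
    rw [Finset.sum_comm]
    simp only [← mul_assoc, ← Finset.sum_mul, ih]
    exact hst.invariant y

/-- If `f` moves by at most `Δ` at every update, then for `k` steps the joint chain can be replaced
by the state chain with a frozen parameter, at the price `k Δ`. -/
theorem transfer_iterate_le (hS : M.IsInvariant F S) {f : Θ → X → ℝ} {Δ : ℝ}
    (hf : ∀ θ ∈ S, ∀ x a y z, 0 < M.behavior.prob x a → f (F x a y θ) z ≤ f θ z + Δ) (k : ℕ)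
    {θ : Θ} (hθ : θ ∈ S) (x : X) :
    (M.transfer F)^[k] f θ x ≤ ∑ y, (M.chain ^ k) x y * f θ y + k * Δ := by
  induction k generalizing θ x with
  | zero => simp [Matrix.one_apply]
  | succ k ih =>
    rw [Function.iterate_succ_apply', transfer]
    have h1 : M.condMean x (fun a y => (M.transfer F)^[k] f (F x a y θ) y)
        ≤ M.condMean x (fun _ y => ∑ z, (M.chain ^ k) y z * f θ z + ((k + 1 : ℕ) : ℝ) * Δ) := by
      refine M.condMean_le_condMean x fun a y ha => (ih (hS θ hθ x a y ha) y).trans ?_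
      have h2 : ∑ z, (M.chain ^ k) y z * f (F x a y θ) z
          ≤ ∑ z, (M.chain ^ k) y z * (f θ z + Δ) :=
        Finset.sum_le_sum fun z _ =>
          mul_le_mul_of_nonneg_left (hf θ hθ x a y z ha) (chain_pow_nonneg k y z)
      simp only [mul_add, Finset.sum_add_distrib, ← Finset.sum_mul, sum_chain_pow] at h2
      push_cast
      linarith
    refine h1.trans (le_of_eq ?_)
    rw [M.condMean_add x (fun _ y => ∑ z, (M.chain ^ k) y z * f θ z), M.condMean_const,
      M.condMean_next x (fun y => ∑ z, (M.chain ^ k) y z * f θ z)]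
    congr 1
    simp only [pow_succ', Matrix.mul_apply, Finset.mul_sum, Finset.sum_mul]
    rw [Finset.sum_comm]
    simp only [mul_assoc]

/-- Mixing estimate: at any time the mean of `f` exceeds that of its steady-state average (for
frozen parameter) by at most the drift of `f` during `τ` steps plus the mixing error after `τ`
steps. -/
theorem expect_sub_mean_le (hst : IsStationaryDist M.chain M.mu) (hS : M.IsInvariant F S)
    (hθ₀ : θ₀ ∈ S) {f : Θ → X → ℝ} {Δ B ε : ℝ} {τ : ℕ}
    (hf : ∀ θ ∈ S, ∀ x a y z, 0 < M.behavior.prob x a → |f (F x a y θ) z - f θ z| ≤ Δ)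
    (hB : ∀ θ ∈ S, ∀ z, |f θ z| ≤ B) (hΔ : 0 ≤ Δ) (hB0 : 0 ≤ B) (hε : 0 ≤ ε)
    (hτ : ∀ x, tvDist ((M.chain ^ τ) x) M.mu ≤ ε) (n : ℕ) :
    M.expect F θ₀ n (fun θ x => f θ x - ∑ z, M.mu z * f θ z) ≤ 2 * (τ * Δ) + 2 * (B * ε) := by
  set ξ : Θ → X → ℝ := fun θ x => f θ x - ∑ z, M.mu z * f θ z with hξ
  have hdrift : ∀ θ ∈ S, ∀ x a y z, 0 < M.behavior.prob x a → ξ (F x a y θ) z ≤ ξ θ z + 2 * Δ := by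
    intro θ hθ x a y z ha
    have h1 : ∑ w, M.mu w * f θ w ≤ ∑ w, M.mu w * (f (F x a y θ) w + Δ) :=
      Finset.sum_le_sum fun w _ => mul_le_mul_of_nonneg_left
        (by linarith [(abs_le.mp (hf θ hθ x a y w ha)).1]) (hst.nonneg w)
    simp only [mul_add, Finset.sum_add_distrib, ← Finset.sum_mul, hst.sum_one] at h1
    have h2 := (abs_le.mp (hf θ hθ x a y z ha)).2
    simp only [hξ]
    linarith
  rcases le_or_gt τ n with hn | hn
  · obtain ⟨m, rfl⟩ := Nat.exists_eq_add_of_le' hn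
    rw [expect_add_index]
    refine (expect_le_expect (g := fun _ _ => 2 * (τ * Δ) + 2 * (B * ε)) hst hS hθ₀ m
      fun θ hθ x => (transfer_iterate_le hS hdrift τ hθ x).trans ?_).trans
        (expect_const hst m _).le
    have h1 := sum_mul_sub_le_tvDist ((M.chain ^ τ) x) M.mu (f θ) (hB θ hθ)
    have h2 : ∑ y, (M.chain ^ τ) x y * ξ θ y
        = ∑ y, (M.chain ^ τ) x y * f θ y - ∑ z, M.mu z * f θ z := by
      simp only [hξ, mul_sub, Finset.sum_sub_distrib, ← Finset.sum_mul, sum_chain_pow, one_mul]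
    have h3 : 2 * B * tvDist ((M.chain ^ τ) x) M.mu ≤ 2 * B * ε :=
      mul_le_mul_of_nonneg_left (hτ x) (by positivity)
    linarith
  · -- before time `τ` the stationarity of the initial state gives mean zero at frozen parameter
    have h1 : M.expect F θ₀ n ξ
        ≤ ∑ x, M.mu x * (∑ y, (M.chain ^ n) x y * ξ θ₀ y + n * (2 * Δ)) :=
      Finset.sum_le_sum fun x _ =>
        mul_le_mul_of_nonneg_left (transfer_iterate_le hS hdrift n hθ₀ x) (hst.nonneg x)
    have h2 : ∑ x, M.mu x * ∑ y, (M.chain ^ n) x y * ξ θ₀ y = 0 := by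
      simp only [Finset.mul_sum]
      rw [Finset.sum_comm]
      simp only [← mul_assoc, ← Finset.sum_mul, sum_mu_mul_chain_pow hst]
      simp only [hξ, mul_sub, Finset.sum_sub_distrib, ← Finset.sum_mul, hst.sum_one, one_mul,
        sub_self]
    simp only [mul_add, Finset.sum_add_distrib, ← Finset.sum_mul, hst.sum_one, h2] at h1
    have h3 : (n : ℝ) * Δ ≤ τ * Δ := mul_le_mul_of_nonneg_right (by exact_mod_cast hn.le) hΔ
    have h4 : 0 ≤ B * ε := mul_nonneg hB0 hε
    linarith

/-- The set defining the mixing time is nonempty, so that its infimum is attained. -/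
theorem mixingTime_spec {m ρ ε : ℝ} (h : M.GeomMixing m ρ) (hε : 0 < ε) :
    1 ≤ mixingTime m ρ ε ∧
      ∀ x, tvDist ((M.chain ^ mixingTime m ρ ε) x) M.mu ≤ ε := by
  have hne : {n : ℕ | 1 ≤ n ∧ m * ρ ^ n ≤ ε}.Nonempty := by
    obtain ⟨n, hn⟩ := exists_pow_lt_of_lt_one (div_pos hε h.m_pos) h.rate_lt_one
    refine ⟨n + 1, by omega, ?_⟩
    have h1 : ρ ^ (n + 1) ≤ ρ ^ n := pow_le_pow_of_le_one h.rate_pos.le h.rate_lt_one.le (by omega)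
    have h2 := (lt_div_iff₀' h.m_pos).mp hn
    have h3 := mul_le_mul_of_nonneg_left h1 h.m_pos.le
    linarith
  obtain ⟨h1, h2⟩ : 1 ≤ mixingTime m ρ ε ∧ m * ρ ^ mixingTime m ρ ε ≤ ε := Nat.sInf_mem hne
  refine ⟨h1, fun x => (h.bound _ x).trans (le_trans ?_ h2)⟩
  exact mul_le_mul_of_nonneg_left
    (pow_le_pow_of_le_one h.rate_pos.le h.rate_lt_one.le (by omega)) h.m_pos.le

end Mixing

/-! ### Expectations along a trajectory -/

section Trajectory

variable {Ω : Type*} [MeasurableSpace Ω] {P : Measure Ω} [IsProbabilityMeasure P]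
  {x : ℕ → Ω → X} {a : ℕ → Ω → A}

/-- The event that the trajectory follows the states `s` up to time `n` and the actions `b` before
time `n`. -/
def pathEvent (x : ℕ → Ω → X) (a : ℕ → Ω → A) (n : ℕ) (s : ℕ → X) (b : ℕ → A) : Set Ω :=
  {ω | (∀ k ≤ n, x k ω = s k) ∧ ∀ k < n, a k ω = b k}

omit [IsProbabilityMeasure P] in
theorem measurableSet_pathEvent (h : M.IsTrajectory P x a) (n : ℕ) (s : ℕ → X) (b : ℕ → A) :
    MeasurableSet (pathEvent x a n s b) := by
  have e : pathEvent x a n s b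
      = (⋂ k ∈ Set.Iic n, x k ⁻¹' {s k}) ∩ ⋂ k ∈ Set.Iio n, a k ⁻¹' {b k} := by
    ext ω
    simp [pathEvent]
  rw [e]
  exact (MeasurableSet.biInter (Set.to_countable _) fun k _ => h.meas_state k _).inter
    (MeasurableSet.biInter (Set.to_countable _) fun k _ => h.meas_action k _)

omit [Fintype X] [Fintype A] in
/-- The iterate at time `n` depends only on the path up to time `n`. -/
theorem iterates_eq_of_path_eq {th : (ℕ → X) → (ℕ → A) → ℕ → Θ} (h0 : ∀ s b, th s b 0 = θ₀)
    (hs : ∀ s b n, th s b (n + 1) = F (s n) (b n) (s (n + 1)) (th s b n))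
    {n : ℕ} {s s' : ℕ → X} {b b' : ℕ → A} (h1 : ∀ k ≤ n, s k = s' k) (h2 : ∀ k < n, b k = b' k) :
    th s b n = th s' b' n := by
  induction n with
  | zero => rw [h0, h0]
  | succ n ih =>
    rw [hs, hs, ih (fun k hk => h1 k (by omega)) (fun k hk => h2 k (by omega)), h1 n (by omega),
      h1 (n + 1) le_rfl, h2 n (by omega)]

omit [IsProbabilityMeasure P] in
theorem measureReal_pathEvent_succ (h : M.IsTrajectory P x a) (n : ℕ) (s : ℕ → X) (b : ℕ → A)
    (c : A) (y : X) :
    P.real (pathEvent x a (n + 1) (Function.update s (n + 1) y) (Function.update b n c))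
      = P.real (pathEvent x a n s b) * (M.behavior.prob (s n) c * M.trans c (s n) y) := by
  rw [pathEvent, pathEvent, h.law, h.law, Finset.prod_range_succ, ← mul_assoc]
  congr 1
  · rw [Function.update_of_ne (by omega)]
    congr 1
    refine Finset.prod_congr rfl fun k hk => ?_
    have hk := Finset.mem_range.mp hk
    rw [Function.update_of_ne (by omega), Function.update_of_ne (by omega),
      Function.update_of_ne (by omega)]
  · rw [Function.update_of_ne (by omega), Function.update_self, Function.update_self]

omit [Fintype X] [Fintype A] [MeasurableSpace Ω] in
theorem pathEvent_eq_iUnion (n : ℕ) (s : ℕ → X) (b : ℕ → A) :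
    pathEvent x a n s b = ⋃ p : A × X,
      pathEvent x a (n + 1) (Function.update s (n + 1) p.2) (Function.update b n p.1) := by
  ext ω
  simp only [Set.mem_iUnion, pathEvent, Set.mem_ofPred_eq]
  constructor
  · rintro ⟨h1, h2⟩
    refine ⟨(a n ω, x (n + 1) ω), fun k hk => ?_, fun k hk => ?_⟩
    · rcases eq_or_ne k (n + 1) with rfl | hne
      · rw [Function.update_self]
      · rw [Function.update_of_ne hne]
        exact h1 k (by omega)
    · rcases eq_or_ne k n with rfl | hne
      · rw [Function.update_self]
      · rw [Function.update_of_ne hne]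
        exact h2 k (by omega)
  · rintro ⟨p, h1, h2⟩
    refine ⟨fun k hk => ?_, fun k hk => ?_⟩
    · rw [h1 k (by omega), Function.update_of_ne (by omega)]
    · rw [h2 k (by omega), Function.update_of_ne (by omega)]

omit [Fintype X] [Fintype A] [MeasurableSpace Ω] in
theorem pairwise_disjoint_pathEvent (n : ℕ) (s : ℕ → X) (b : ℕ → A) :
    Pairwise (Function.onFun Disjoint fun p : A × X =>
      pathEvent x a (n + 1) (Function.update s (n + 1) p.2) (Function.update b n p.1)) := by
  intro p q hpq
  rw [Function.onFun, Set.disjoint_left]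
  rintro ω ⟨h1, h2⟩ ⟨h3, h4⟩
  refine hpq (Prod.ext ?_ ?_)
  · have e1 := h2 n (by omega)
    have e2 := h4 n (by omega)
    rw [Function.update_self] at e1 e2
    rw [← e1, e2]
  · have e1 := h1 (n + 1) le_rfl
    have e2 := h3 (n + 1) le_rfl
    rw [Function.update_self] at e1 e2
    rw [← e1, e2]

/-- Markov property on a path event: conditionally on the path up to time `n`, the mean of `f` at
time `n + j` is given by the `j`-th power of the transfer operator. -/
theorem setIntegral_pathEvent (h : M.IsTrajectory P x a) {th : (ℕ → X) → (ℕ → A) → ℕ → Θ}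
    (h0 : ∀ s b, th s b 0 = θ₀)
    (hs : ∀ s b n, th s b (n + 1) = F (s n) (b n) (s (n + 1)) (th s b n))
    (f : Θ → X → ℝ) (j n : ℕ) (s : ℕ → X) (b : ℕ → A) :
    IntegrableOn (fun ω => f (th (fun k => x k ω) (fun k => a k ω) (n + j)) (x (n + j) ω))
        (pathEvent x a n s b) P ∧
      ∫ ω in pathEvent x a n s b,
          f (th (fun k => x k ω) (fun k => a k ω) (n + j)) (x (n + j) ω) ∂P
        = P.real (pathEvent x a n s b) * (M.transfer F)^[j] f (th s b n) (s n) := by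
  induction j generalizing n s b with
  | zero =>
    have hm := measurableSet_pathEvent h n s b
    have hE : Set.EqOn (fun ω => f (th (fun k => x k ω) (fun k => a k ω) (n + 0)) (x (n + 0) ω))
        (fun _ => f (th s b n) (s n)) (pathEvent x a n s b) := by
      rintro ω ⟨h1, h2⟩
      simp only [add_zero]
      rw [iterates_eq_of_path_eq h0 hs h1 h2, h1 n le_rfl]
    refine ⟨(integrableOn_congr_fun hE hm).mpr (integrableOn_const (by finiteness)), ?_⟩
    rw [setIntegral_congr_fun hm hE, setIntegral_const, smul_eq_mul]
    rfl
  | succ j ih =>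
    have hm := fun p : A × X => measurableSet_pathEvent h (n + 1) (Function.update s (n + 1) p.2)
      (Function.update b n p.1)
    have hi := fun p : A × X => ih (n + 1) (Function.update s (n + 1) p.2)
      (Function.update b n p.1)
    have e : n + (j + 1) = n + 1 + j := by omega
    rw [e]
    constructor
    · rw [pathEvent_eq_iUnion]
      exact integrableOn_finite_iUnion.mpr fun p => (hi p).1
    · conv_lhs => rw [pathEvent_eq_iUnion]
      rw [integral_iUnion_fintype hm (pairwise_disjoint_pathEvent n s b) fun p => (hi p).1]
      simp only [fun p => (hi p).2, measureReal_pathEvent_succ h]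
      rw [Function.iterate_succ_apply', transfer, condMean, Fintype.sum_prod_type, Finset.mul_sum]
      refine Finset.sum_congr rfl fun c _ => ?_
      rw [Finset.mul_sum]
      refine Finset.sum_congr rfl fun y _ => ?_
      have e1 : th (Function.update s (n + 1) y) (Function.update b n c) n = th s b n :=
        iterates_eq_of_path_eq h0 hs (fun k hk => Function.update_of_ne (by omega) _ _)
          (fun k hk => Function.update_of_ne (by omega) _ _)
      rw [hs, e1]
      simp only [Function.update_self, Function.update_of_ne (Nat.succ_ne_self n).symm]
      ring

/-- Expectations of functions of the iterate and the state at time `n` are computed by the transfer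
operator. -/
theorem integral_eq_expect (h : M.IsTrajectory P x a) {th : (ℕ → X) → (ℕ → A) → ℕ → Θ}
    (h0 : ∀ s b, th s b 0 = θ₀)
    (hs : ∀ s b n, th s b (n + 1) = F (s n) (b n) (s (n + 1)) (th s b n))
    (f : Θ → X → ℝ) (n : ℕ) :
    ∫ ω, f (th (fun k => x k ω) (fun k => a k ω) n) (x n ω) ∂P = M.expect F θ₀ n f := by
  obtain ⟨ω₀⟩ : Nonempty Ω := nonempty_of_isProbabilityMeasure P
  have hu : (Set.univ : Set Ω) = ⋃ y : X, pathEvent x a 0 (fun _ => y) (fun k => a k ω₀) := by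
    ext ω
    simp [pathEvent]
  have hd : Pairwise (Function.onFun Disjoint fun y : X =>
      pathEvent x a 0 (fun _ => y) (fun k => a k ω₀)) := by
    intro p q hpq
    rw [Function.onFun, Set.disjoint_left]
    rintro ω ⟨h1, -⟩ ⟨h3, -⟩
    exact hpq ((h1 0 le_rfl).symm.trans (h3 0 le_rfl))
  have hi := fun y : X => setIntegral_pathEvent h h0 hs f n 0 (fun _ => y) (fun k => a k ω₀)
  simp only [zero_add] at hi
  rw [← setIntegral_univ, hu, integral_iUnion_fintype
    (fun y => measurableSet_pathEvent h 0 _ _) hd fun y => (hi y).1, expect]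
  refine Finset.sum_congr rfl fun y _ => ?_
  rw [(hi y).2, h0, pathEvent, h.law]
  simp

end Trajectory

end TDCProblem

/-! ### Uniform geometric ergodicity of the state chain -/

namespace TDCProblem

variable {X A : Type*} [Fintype X] [Fintype A] {d : ℕ} {M : TDCProblem X A d} [DecidableEq X]

theorem chain_pow_mul_le (k l : ℕ) (x y z : X) :
    (M.chain ^ k) x y * (M.chain ^ l) y z ≤ (M.chain ^ (k + l)) x z := by
  rw [pow_add, Matrix.mul_apply]
  exact Finset.single_le_sum (f := fun y => (M.chain ^ k) x y * (M.chain ^ l) y z)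
    (fun w _ => mul_nonneg (chain_pow_nonneg k x w) (chain_pow_nonneg l w z)) (Finset.mem_univ y)

/-- An aperiodic state can return after any sufficiently large number of steps. -/
theorem exists_forall_chain_pow_self_pos (h : M.Ergodic) (x : X) :
    ∃ n₀, ∀ n ≥ n₀, 0 < (M.chain ^ n) x x := by
  set s : Set ℕ := {n | 1 ≤ n ∧ 0 < (M.chain ^ n) x x} with hs
  have hgcd : Nat.setGcd s = 1 :=
    h.aperiodic x _ fun n h1 h2 => Nat.setGcd_dvd_of_mem ⟨h1, h2⟩
  obtain ⟨n₀, hn₀⟩ := Nat.exists_mem_closure_of_ge s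
  refine ⟨n₀, fun n hn => ?_⟩
  have hmem := hn₀ n hn (by rw [hgcd]; exact one_dvd n)
  clear hn
  induction hmem using AddSubmonoid.closure_induction with
  | mem n hn => exact hn.2
  | zero => simp
  | add k l _ _ hk hl => exact (mul_pos hk hl).trans_le (chain_pow_mul_le k l x x x)

theorem exists_chain_pow_pos (h : M.Ergodic) :
    ∃ N, 1 ≤ N ∧ ∀ x y, 0 < (M.chain ^ N) x y := by
  choose n₀ hn₀ using exists_forall_chain_pow_self_pos h
  choose k hk using h.irreducible
  refine ⟨∑ x, n₀ x + ∑ x, ∑ y, k x y + 1, by omega, fun x y => ?_⟩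
  have h1 : n₀ x ≤ ∑ x, n₀ x := Finset.single_le_sum (fun _ _ => Nat.zero_le _) (Finset.mem_univ x)
  have h2 : k x y ≤ ∑ x, ∑ y, k x y :=
    (Finset.single_le_sum (f := k x) (fun _ _ => Nat.zero_le _) (Finset.mem_univ y)).trans
      (Finset.single_le_sum (f := fun x => ∑ y, k x y) (fun _ _ => Nat.zero_le _)
        (Finset.mem_univ x))
  obtain ⟨l, hl⟩ : ∃ l, ∑ x, n₀ x + ∑ x, ∑ y, k x y + 1 = l + k x y :=
    ⟨∑ x, n₀ x + ∑ x, ∑ y, k x y + 1 - k x y, by omega⟩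
  rw [hl]
  exact (mul_pos (hn₀ x l (by omega)) (hk x y)).trans_le (chain_pow_mul_le l (k x y) x x y)

/-- Doeblin minorization: some power of the transition matrix dominates a multiple of `mu`. -/
theorem exists_minorization (h : M.Ergodic) :
    ∃ N, 1 ≤ N ∧ ∃ δ : ℝ, 0 < δ ∧ δ < 1 ∧ ∀ x y, δ * M.mu y ≤ (M.chain ^ N) x y := by
  obtain ⟨N, hN, hpos⟩ := exists_chain_pow_pos h
  obtain ⟨x₀, -⟩ : ∃ x, M.mu x ≠ 0 := by
    by_contra! hc
    simpa [hc] using h.stationary.sum_one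
  obtain ⟨p, hp⟩ := @Finite.exists_min (X × X) ℝ _ ⟨(x₀, x₀)⟩ _
    fun p : X × X => (M.chain ^ N) p.1 p.2
  refine ⟨N, hN, min (1 / 2) ((M.chain ^ N) p.1 p.2), lt_min (by norm_num) (hpos _ _),
    (min_le_left _ _).trans_lt (by norm_num), fun x y => ?_⟩
  have h1 : M.mu y ≤ 1 := by
    rw [← h.stationary.sum_one]
    exact Finset.single_le_sum (fun z _ => h.stationary.nonneg z) (Finset.mem_univ y)
  have h2 : 0 ≤ min (1 / 2) ((M.chain ^ N) p.1 p.2) :=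
    le_min (by norm_num) (hpos _ _).le
  exact (mul_le_of_le_one_right h2 h1).trans ((min_le_right _ _).trans (hp (x, y)))

/-- The minorization contracts the `ℓ¹` distance to `mu` by the factor `1 - δ`. -/
theorem sum_abs_chain_pow_sub_le (hst : IsStationaryDist M.chain M.mu) {N : ℕ} {δ : ℝ}
    (hδ : ∀ x y, δ * M.mu y ≤ (M.chain ^ N) x y) (k : ℕ) (x : X) :
    ∑ y, |(M.chain ^ (k + N)) x y - M.mu y|
      ≤ (1 - δ) * ∑ y, |(M.chain ^ k) x y - M.mu y| := by
  have h0 : ∑ z, ((M.chain ^ k) x z - M.mu z) = 0 := by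
    rw [Finset.sum_sub_distrib, sum_chain_pow, hst.sum_one, sub_self]
  have h1 : ∀ y, |(M.chain ^ (k + N)) x y - M.mu y|
      ≤ ∑ z, |(M.chain ^ k) x z - M.mu z| * ((M.chain ^ N) z y - δ * M.mu y) := by
    intro y
    have e : (M.chain ^ (k + N)) x y - M.mu y
        = ∑ z, ((M.chain ^ k) x z - M.mu z) * ((M.chain ^ N) z y - δ * M.mu y) := by
      simp only [mul_sub, Finset.sum_sub_distrib, ← Finset.sum_mul, h0, zero_mul, sub_zero]
      simp only [sub_mul, Finset.sum_sub_distrib, sum_mu_mul_chain_pow hst]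
      rw [pow_add, Matrix.mul_apply]
    rw [e]
    refine (Finset.abs_sum_le_sum_abs _ _).trans (Finset.sum_le_sum fun z _ => ?_)
    rw [abs_mul, abs_of_nonneg (sub_nonneg.mpr (hδ z y))]
  refine (Finset.sum_le_sum fun y _ => h1 y).trans (le_of_eq ?_)
  rw [Finset.sum_comm]
  simp only [← Finset.mul_sum, Finset.sum_sub_distrib, sum_chain_pow, hst.sum_one, mul_one]
  rw [← Finset.sum_mul, mul_comm]

theorem exists_geomMixing (h : M.Ergodic) : ∃ m ρ : ℝ, M.GeomMixing m ρ := by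
  obtain ⟨N, hN, δ, hδ0, hδ1, hδ⟩ := exists_minorization h
  have hst := h.stationary
  set ρ : ℝ := (1 - δ) ^ ((N : ℝ)⁻¹) with hρ
  have hN0 : N ≠ 0 := by omega
  have hρN : ρ ^ N = 1 - δ := Real.rpow_inv_natCast_pow (by linarith) hN0
  have hρ0 : 0 < ρ := Real.rpow_pos_of_pos (by linarith) _
  have hρ1 : ρ < 1 := Real.rpow_lt_one (by linarith) (by linarith) (by positivity)
  refine ⟨(ρ ^ N)⁻¹, ρ, by positivity, hρ0, hρ1, fun k x => ?_⟩
  have hiter : ∀ j r : ℕ, tvDist ((M.chain ^ (r + N * j)) x) M.mu ≤ (ρ ^ N) ^ j := by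
    intro j r
    induction j with
    | zero =>
      have h1 : ∑ y, |(M.chain ^ r) x y - M.mu y| ≤ ∑ y, ((M.chain ^ r) x y + M.mu y) := by
        refine Finset.sum_le_sum fun y _ => (abs_sub _ _).trans ?_
        rw [abs_of_nonneg (chain_pow_nonneg r x y), abs_of_nonneg (hst.nonneg y)]
      rw [Finset.sum_add_distrib, sum_chain_pow, hst.sum_one] at h1
      simp only [tvDist, mul_zero, add_zero, pow_zero]
      linarith
    | succ j ih =>
      have h1 := sum_abs_chain_pow_sub_le hst hδ (r + N * j) x
      rw [show r + N * (j + 1) = r + N * j + N by ring, pow_succ]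
      unfold tvDist at ih ⊢
      rw [hρN] at ih ⊢
      have h2 := mul_le_mul_of_nonneg_left ih (sub_pos.mpr hδ1).le
      linarith
  have hk := hiter (k / N) (k % N)
  rw [Nat.mod_add_div] at hk
  refine hk.trans ?_
  have hr : k % N < N := Nat.mod_lt _ (by omega)
  rw [inv_mul_eq_div, le_div_iff₀ (by positivity), ← pow_mul, ← pow_add]
  refine pow_le_pow_of_le_one hρ0.le hρ1.le ?_
  have := Nat.mod_add_div k N
  omega

end TDCProblem

/-! ### One-step inequalities for the two squared errors -/

namespace TDCProblem

variable {X A : Type*} [Fintype X] [Fintype A] {d : ℕ}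

/-- The pairs `(w, u)` in the product of the two projection balls. -/
def balls (d : ℕ) (Rw Ru : ℝ) : Set (Vec d × Vec d) := {p | ‖p.1‖ ≤ Rw ∧ ‖p.2‖ ≤ Ru}

/-- Conditional mean, given the state, of the inner product of the tracking error with the
direction of `u`. -/
def driftU (M : TDCProblem X A d) (p : Vec d × Vec d) (x : X) : ℝ :=
  M.condMean x fun a y => inner ℝ (M.trackErr p) (M.dirU x a y p.1 p.2)

/-- Conditional mean, given the state, of the inner product of `w - w_*` with the direction of `w`
at `u = u^*(w)`. It does not involve `u`, hence varies on the slow time scale only. -/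
def driftW (M : TDCProblem X A d) (p : Vec d × Vec d) (x : X) : ℝ :=
  M.condMean x fun a y => inner ℝ (p.1 - M.wStar) (M.dirW x a y p.1 (M.uStar p.1))

/-- Lipschitz constant of `driftU` along the iterates, in units of `cβ` (when `cα ≤ cβ`). -/
def lipDriftU (ρmax rmax lamc Rw Ru : ℝ) : ℝ :=
  incBound ρmax rmax Rw Ru * (1 + lipU ρmax lamc) * incBound ρmax rmax Rw Ru
    + 6 * Ru * ρmax * incBound ρmax rmax Rw Ru

/-- Lipschitz constant of `driftW` along the iterates, in units of `cα`. -/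
def lipDriftW (ρmax rmax lamc Rw Ru : ℝ) : ℝ :=
  incBound ρmax rmax Rw Ru ^ 2
    + 2 * Rw * ρmax * (2 + lipU ρmax lamc) * incBound ρmax rmax Rw Ru

/-- Constant of the remainder in the one-step inequality for the tracking error. -/
def remV (ρmax rmax lamc Rw Ru : ℝ) : ℝ :=
  4 * Ru * incBound ρmax rmax Rw Ru + incBound ρmax rmax Rw Ru ^ 2
    + lipU ρmax lamc * incBound ρmax rmax Rw Ru
      * (4 * Ru + 2 * incBound ρmax rmax Rw Ru + lipU ρmax lamc * incBound ρmax rmax Rw Ru)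

/-- Constant of the remainder in the one-step inequality for `‖w - w_*‖²`. -/
def remW (ρmax rmax Rw Ru : ℝ) : ℝ :=
  4 * Rw * incBound ρmax rmax Rw Ru + incBound ρmax rmax Rw Ru ^ 2

theorem abs_inner_sub_inner_le {d : ℕ} (v v' g g' : Vec d) :
    |(inner ℝ v' g' : ℝ) - inner ℝ v g| ≤ ‖v' - v‖ * ‖g'‖ + ‖v‖ * ‖g' - g‖ := by
  have e : (inner ℝ v' g' : ℝ) - inner ℝ v g = inner ℝ (v' - v) g' + inner ℝ v (g' - g) := by
    rw [inner_sub_left, inner_sub_right]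
    ring
  rw [e]
  exact (abs_add_le _ _).trans (add_le_add (abs_real_inner_le_norm _ _)
    (abs_real_inner_le_norm _ _))

/-- Expansion of the square of `‖z + q‖` when `q` is `c • g` up to second order in `c`. -/
theorem norm_add_sq_le_of_approx {d : ℕ} {z q g : Vec d} {c B G : ℝ} (hz : ‖z‖ ≤ B) (hq : ‖q‖ ≤ c * G) (hqg : ‖q - c • g‖ ≤ c ^ 2 * G) :
    ‖z + q‖ ^ 2 ≤ ‖z‖ ^ 2 + 2 * c * inner ℝ z g + c ^ 2 * (2 * B * G + G ^ 2) := by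
  have e : inner ℝ z q = c * inner ℝ z g + inner ℝ z (q - c • g) := by
    rw [inner_sub_right, real_inner_smul_right]
    ring
  have h1 : inner ℝ z (q - c • g) ≤ B * (c ^ 2 * G) :=
    (real_inner_le_norm _ _).trans (mul_le_mul hz hqg (norm_nonneg _) ((norm_nonneg _).trans hz))
  have h2 : ‖q‖ ^ 2 ≤ (c * G) ^ 2 := pow_le_pow_left₀ (norm_nonneg _) hq 2
  rw [norm_add_sq_real, e]
  nlinarith

variable {M : TDCProblem X A d} {ρmax rmax lamc lamu lamw Rw Ru : ℝ} {cα cβ : ℝ}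

namespace Standing

theorem isInvariant_balls (h : M.Standing ρmax rmax lamc lamu lamw Rw Ru) :
    M.IsInvariant (M.step cα cβ Rw Ru) (balls d Rw Ru) :=
  fun _ _ _ _ _ _ => ⟨norm_ballProj_le h.Rw_pos.le _, norm_ballProj_le h.Ru_pos.le _⟩

theorem norm_trackErr_le (h : M.Standing ρmax rmax lamc lamu lamw Rw Ru) {p : Vec d × Vec d}
    (hp : p ∈ balls d Rw Ru) : ‖M.trackErr p‖ ≤ 2 * Ru :=
  (norm_sub_le _ _).trans (by linarith [hp.2, h.norm_uStar_le hp.1])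

theorem norm_sub_wStar_le (h : M.Standing ρmax rmax lamc lamu lamw Rw Ru) {p : Vec d × Vec d}
    (hp : p ∈ balls d Rw Ru) : ‖p.1 - M.wStar‖ ≤ 2 * Rw :=
  (norm_sub_le _ _).trans (by linarith [hp.1, h.wStar])

theorem norm_step_sub_le (h : M.Standing ρmax rmax lamc lamu lamw Rw Ru) (hα : 0 < cα)
    (hα1 : cα ≤ 1) (hβ : 0 < cβ) {p : Vec d × Vec d} (hp : p ∈ balls d Rw Ru) {x : X} {a : A}
    (y : X) (ha : 0 < M.behavior.prob x a) :
    ‖(M.step cα cβ Rw Ru x a y p).1 - p.1‖ ≤ cα * incBound ρmax rmax Rw Ru ∧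
      ‖(M.step cα cβ Rw Ru x a y p).2 - p.2‖ ≤ cβ * incBound ρmax rmax Rw Ru := by
  obtain ⟨w, u⟩ := p
  obtain ⟨dw, du, e, h1, -, h2, -⟩ := h.exists_step_eq y ha hα hα1 hβ hp.1 hp.2
  rw [e]
  constructor
  · refine (norm_ballProj_sub_le h.Rw_pos.le _ hp.1).trans ?_
    simpa using h1
  · refine (norm_ballProj_sub_le h.Ru_pos.le _ hp.2).trans ?_
    simpa using h2

theorem norm_trackErr_step_sub_le (h : M.Standing ρmax rmax lamc lamu lamw Rw Ru) (hα : 0 < cα)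
    (hα1 : cα ≤ 1) (hβ : 0 < cβ) {p : Vec d × Vec d} (hp : p ∈ balls d Rw Ru) {x : X} {a : A}
    (y : X) (ha : 0 < M.behavior.prob x a) :
    ‖M.trackErr (M.step cα cβ Rw Ru x a y p) - M.trackErr p‖
      ≤ cβ * incBound ρmax rmax Rw Ru + lipU ρmax lamc * (cα * incBound ρmax rmax Rw Ru) := by
  obtain ⟨h1, h2⟩ := h.norm_step_sub_le hα hα1 hβ hp y ha
  set p' := M.step cα cβ Rw Ru x a y p
  have e : M.trackErr p' - M.trackErr p = (p'.2 - p.2) - (M.uStar p'.1 - M.uStar p.1) := by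
    rw [trackErr, trackErr]
    abel
  rw [e]
  exact (norm_sub_le _ _).trans (add_le_add h2 ((h.norm_uStar_sub_le _ _).trans
    (mul_le_mul_of_nonneg_left h1 h.lipU_nonneg)))

theorem abs_driftU_le (h : M.Standing ρmax rmax lamc lamu lamw Rw Ru) {p : Vec d × Vec d}
    (hp : p ∈ balls d Rw Ru) (x : X) :
    |M.driftU p x| ≤ 2 * Ru * incBound ρmax rmax Rw Ru :=
  M.abs_condMean_le x fun _ y ha => (abs_real_inner_le_norm _ _).trans
    (mul_le_mul (h.norm_trackErr_le hp) (h.norm_dirU_le y ha hp.1 hp.2) (norm_nonneg _)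
      (by linarith [h.Ru_pos]))

theorem abs_driftW_le (h : M.Standing ρmax rmax lamc lamu lamw Rw Ru) {p : Vec d × Vec d}
    (hp : p ∈ balls d Rw Ru) (x : X) :
    |M.driftW p x| ≤ 2 * Rw * incBound ρmax rmax Rw Ru :=
  M.abs_condMean_le x fun _ y ha => (abs_real_inner_le_norm _ _).trans
    (mul_le_mul (h.norm_sub_wStar_le hp) (h.norm_dirW_le y ha hp.1 (h.norm_uStar_le hp.1))
      (norm_nonneg _) (by linarith [h.Rw_pos]))

theorem abs_driftU_step_sub_le (h : M.Standing ρmax rmax lamc lamu lamw Rw Ru) (hα : 0 < cα)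
    (hαβ : cα ≤ cβ) (hβ1 : cβ ≤ 1) {p : Vec d × Vec d} (hp : p ∈ balls d Rw Ru) {x : X} {a : A}
    (y z : X) (ha : 0 < M.behavior.prob x a) :
    |M.driftU (M.step cα cβ Rw Ru x a y p) z - M.driftU p z|
      ≤ cβ * lipDriftU ρmax rmax lamc Rw Ru := by
  have hβ := hα.trans_le hαβ
  have hp' := h.isInvariant_balls (cα := cα) (cβ := cβ) p hp x a y ha
  obtain ⟨h1, h2⟩ := h.norm_step_sub_le hα (hαβ.trans hβ1) hβ hp y ha
  have h3 := h.norm_trackErr_step_sub_le hα (hαβ.trans hβ1) hβ hp y ha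
  set p' := M.step cα cβ Rw Ru x a y p
  set G := incBound ρmax rmax Rw Ru with hG
  set L := lipU ρmax lamc with hL
  have hG0 : 0 < G := h.incBound_pos
  have hL0 : 0 ≤ L := h.lipU_nonneg
  have hρ := h.ρmax_pos
  have hRu := h.Ru_pos
  have hGαβ : cα * G ≤ cβ * G := mul_le_mul_of_nonneg_right hαβ hG0.le
  have h3' : ‖M.trackErr p' - M.trackErr p‖ ≤ cβ * (G * (1 + L)) := by
    have := mul_le_mul_of_nonneg_left hGαβ hL0
    linarith
  refine M.abs_condMean_sub_le z fun c t hc => (abs_inner_sub_inner_le _ _ _ _).trans ?_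
  have h4 : ‖M.dirU z c t p'.1 p'.2 - M.dirU z c t p.1 p.2‖ ≤ ρmax * (3 * (cβ * G)) :=
    (h.norm_dirU_sub_le t hc _ _ _ _).trans (mul_le_mul_of_nonneg_left (by linarith) hρ.le)
  calc ‖M.trackErr p' - M.trackErr p‖ * ‖M.dirU z c t p'.1 p'.2‖
        + ‖M.trackErr p‖ * ‖M.dirU z c t p'.1 p'.2 - M.dirU z c t p.1 p.2‖
      ≤ (cβ * (G * (1 + L))) * G + (2 * Ru) * (ρmax * (3 * (cβ * G))) := by
        gcongr
        · exact h.norm_dirU_le t hc hp'.1 hp'.2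
        · exact h.norm_trackErr_le hp
    _ = cβ * lipDriftU ρmax rmax lamc Rw Ru := by rw [lipDriftU]; ring

theorem abs_driftW_step_sub_le (h : M.Standing ρmax rmax lamc lamu lamw Rw Ru) (hα : 0 < cα)
    (hα1 : cα ≤ 1) (hβ : 0 < cβ) {p : Vec d × Vec d} (hp : p ∈ balls d Rw Ru) {x : X} {a : A}
    (y z : X) (ha : 0 < M.behavior.prob x a) :
    |M.driftW (M.step cα cβ Rw Ru x a y p) z - M.driftW p z|
      ≤ cα * lipDriftW ρmax rmax lamc Rw Ru := by
  have hp' := h.isInvariant_balls (cα := cα) (cβ := cβ) p hp x a y ha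
  obtain ⟨h1, -⟩ := h.norm_step_sub_le hα hα1 hβ hp y ha
  set p' := M.step cα cβ Rw Ru x a y p
  set G := incBound ρmax rmax Rw Ru with hG
  set L := lipU ρmax lamc with hL
  have hG0 : 0 < G := h.incBound_pos
  have hL0 : 0 ≤ L := h.lipU_nonneg
  have hρ := h.ρmax_pos
  have hRw := h.Rw_pos
  refine M.abs_condMean_sub_le z fun c t hc => (abs_inner_sub_inner_le _ _ _ _).trans ?_
  have h3 : ‖M.uStar p'.1 - M.uStar p.1‖ ≤ L * (cα * G) :=
    (h.norm_uStar_sub_le _ _).trans (mul_le_mul_of_nonneg_left h1 hL0)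
  have h4 : ‖M.dirW z c t p'.1 (M.uStar p'.1) - M.dirW z c t p.1 (M.uStar p.1)‖
      ≤ ρmax * ((2 + L) * (cα * G)) :=
    (h.norm_dirW_sub_le t hc _ _ _ _).trans (mul_le_mul_of_nonneg_left (by linarith) hρ.le)
  calc ‖p'.1 - M.wStar - (p.1 - M.wStar)‖ * ‖M.dirW z c t p'.1 (M.uStar p'.1)‖
        + ‖p.1 - M.wStar‖ *
          ‖M.dirW z c t p'.1 (M.uStar p'.1) - M.dirW z c t p.1 (M.uStar p.1)‖
      ≤ (cα * G) * G + (2 * Rw) * (ρmax * ((2 + L) * (cα * G))) := by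
        rw [sub_sub_sub_cancel_right]
        gcongr
        · exact h.norm_dirW_le t hc hp'.1 (h.norm_uStar_le hp'.1)
        · exact h.norm_sub_wStar_le hp
    _ = cα * lipDriftW ρmax rmax lamc Rw Ru := by rw [lipDriftW]; ring

theorem two_mul_sum_mu_driftU_le (h : M.Standing ρmax rmax lamc lamu lamw Rw Ru)
    (p : Vec d × Vec d) :
    2 * ∑ x, M.mu x * M.driftU p x ≤ lamu * ‖M.trackErr p‖ ^ 2 := by
  simp only [driftU]
  rw [M.sum_mu_mul_condMean_inner (M.trackErr p) (fun x a y => M.dirU x a y p.1 p.2),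
    M.mean_dirU h.solvable.C_nonsing]
  exact h.inner_matC_le _

theorem two_mul_sum_mu_driftW_le (h : M.Standing ρmax rmax lamc lamu lamw Rw Ru)
    (p : Vec d × Vec d) :
    2 * ∑ x, M.mu x * M.driftW p x ≤ lamw * ‖p.1 - M.wStar‖ ^ 2 := by
  simp only [driftW]
  rw [M.sum_mu_mul_condMean_inner (p.1 - M.wStar) (fun x a y => M.dirW x a y p.1 (M.uStar p.1)),
    M.mean_dirW h.solvable.A_nonsing h.solvable.C_nonsing]
  exact h.inner_matACA_le _

/-- One-step inequality for the tracking error; the term of order `cα` is due to the motion of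
`u^*(w)`. -/
theorem transfer_trackErr_sq_le (h : M.Standing ρmax rmax lamc lamu lamw Rw Ru) (hα : 0 < cα)
    (hα1 : cα ≤ 1) (hβ : 0 < cβ) (hβ1 : cβ ≤ 1) {p : Vec d × Vec d} (hp : p ∈ balls d Rw Ru)
    (x : X) :
    M.transfer (M.step cα cβ Rw Ru) (fun p _ => ‖M.trackErr p‖ ^ 2) p x
      ≤ ‖M.trackErr p‖ ^ 2 + 2 * cβ * M.driftU p x
        + remV ρmax rmax lamc Rw Ru * (cα + cβ ^ 2) := by
  have e : ‖M.trackErr p‖ ^ 2 + 2 * cβ * M.driftU p x + remV ρmax rmax lamc Rw Ru * (cα + cβ ^ 2)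
      = M.condMean x fun a y => 2 * cβ * inner ℝ (M.trackErr p) (M.dirU x a y p.1 p.2)
        + (‖M.trackErr p‖ ^ 2 + remV ρmax rmax lamc Rw Ru * (cα + cβ ^ 2)) := by
    rw [M.condMean_add x (fun a y => 2 * cβ * inner ℝ (M.trackErr p) (M.dirU x a y p.1 p.2)),
      M.condMean_const, M.condMean_const_mul, driftU]
    ring
  rw [e, transfer]
  clear e
  refine M.condMean_le_condMean x fun a y ha => ?_
  obtain ⟨w, u⟩ := p
  obtain ⟨dw, du, e, h1, -, h2, h3⟩ := h.exists_step_eq y ha hα hα1 hβ hp.1 hp.2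
  set v := M.trackErr (w, u) with hv
  set G := incBound ρmax rmax Rw Ru with hG
  set L := lipU ρmax lamc with hL
  have hG0 : 0 < G := h.incBound_pos
  have hL0 : 0 ≤ L := h.lipU_nonneg
  have hRu := h.Ru_pos
  have hv2 : ‖v‖ ≤ 2 * Ru := h.norm_trackErr_le hp
  have h4 : ‖v + du‖ ≤ 2 * Ru + G :=
    (norm_add_le _ _).trans (add_le_add hv2 (h2.trans (mul_le_of_le_one_left hG0.le hβ1)))
  have h5 : ‖M.uStar w - M.uStar (ballProj Rw (w + dw))‖ ≤ L * (cα * G) := by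
    refine (h.norm_uStar_sub_le _ _).trans (mul_le_mul_of_nonneg_left ?_ hL0)
    rw [norm_sub_rev]
    refine (norm_ballProj_sub_le h.Rw_pos.le _ hp.1).trans ?_
    simpa using h1
  have h6 : ‖ballProj Ru (u + du) - M.uStar w‖ ≤ ‖v + du‖ := by
    refine (norm_ballProj_sub_le h.Ru_pos.le _ (h.norm_uStar_le hp.1)).trans (le_of_eq ?_)
    rw [hv, trackErr]
    congr 1
    abel
  have h7 : ‖M.trackErr (M.step cα cβ Rw Ru x a y (w, u))‖ ≤ ‖v + du‖ + L * (cα * G) := by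
    rw [e, trackErr]
    have e2 : ballProj Ru (u + du) - M.uStar (ballProj Rw (w + dw))
        = (ballProj Ru (u + du) - M.uStar w)
          + (M.uStar w - M.uStar (ballProj Rw (w + dw))) := by abel
    simp only [e2]
    exact (norm_add_le _ _).trans (add_le_add h6 h5)
  have h8 := norm_add_sq_le_of_approx hv2 h2 h3
  have h9 : ‖M.trackErr (M.step cα cβ Rw Ru x a y (w, u))‖ ^ 2
      ≤ (‖v + du‖ + L * (cα * G)) ^ 2 := pow_le_pow_left₀ (norm_nonneg _) h7 2
  have hLG : 0 ≤ L * G := mul_nonneg hL0 hG0.le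
  have h10 : (L * G * cα) * ‖v + du‖ ≤ (L * G * cα) * (2 * Ru + G) :=
    mul_le_mul_of_nonneg_left h4 (mul_nonneg hLG hα.le)
  have h11 : (L * G) ^ 2 * cα ^ 2 ≤ (L * G) ^ 2 * cα :=
    mul_le_mul_of_nonneg_left (by nlinarith) (by positivity)
  have h12 : 0 ≤ cα * (4 * Ru * G + G ^ 2) := by positivity
  have h13 : 0 ≤ cβ ^ 2 * (L * G * (4 * Ru + 2 * G + L * G)) := by positivity
  have e3 : remV ρmax rmax lamc Rw Ru * (cα + cβ ^ 2)
      = cβ ^ 2 * (2 * (2 * Ru) * G + G ^ 2) + (2 * ((L * G * cα) * (2 * Ru + G))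
        + (L * G) ^ 2 * cα) + cα * (4 * Ru * G + G ^ 2)
        + cβ ^ 2 * (L * G * (4 * Ru + 2 * G + L * G)) := by
    rw [remV]
    ring
  rw [e3]
  have e4 : (‖v + du‖ + L * (cα * G)) ^ 2
      = ‖v + du‖ ^ 2 + 2 * ((L * G * cα) * ‖v + du‖) + (L * G) ^ 2 * cα ^ 2 := by ring
  linarith

/-- One-step inequality for `‖w - w_*‖²`: replacing `u` by `u^*(w)` in the direction costs a term of
order `cα ‖v‖`, which leaves a drift that depends on `w` only. -/
theorem transfer_sub_wStar_sq_le (h : M.Standing ρmax rmax lamc lamu lamw Rw Ru) (hα : 0 < cα)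
    (hα1 : cα ≤ 1) (hβ : 0 < cβ) {p : Vec d × Vec d} (hp : p ∈ balls d Rw Ru) (x : X) :
    M.transfer (M.step cα cβ Rw Ru) (fun p _ => ‖p.1 - M.wStar‖ ^ 2) p x
      ≤ ‖p.1 - M.wStar‖ ^ 2 + 2 * cα * M.driftW p x
        + 4 * Rw * ρmax * cα * ‖M.trackErr p‖ + remW ρmax rmax Rw Ru * cα ^ 2 := by
  have e : ‖p.1 - M.wStar‖ ^ 2 + 2 * cα * M.driftW p x
        + 4 * Rw * ρmax * cα * ‖M.trackErr p‖ + remW ρmax rmax Rw Ru * cα ^ 2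
      = M.condMean x fun a y =>
        2 * cα * inner ℝ (p.1 - M.wStar) (M.dirW x a y p.1 (M.uStar p.1))
        + (‖p.1 - M.wStar‖ ^ 2 + 4 * Rw * ρmax * cα * ‖M.trackErr p‖
          + remW ρmax rmax Rw Ru * cα ^ 2) := by
    rw [M.condMean_add x
        (fun a y => 2 * cα * inner ℝ (p.1 - M.wStar) (M.dirW x a y p.1 (M.uStar p.1))),
      M.condMean_const, M.condMean_const_mul, driftW]
    ring
  rw [e, transfer]
  clear e
  refine M.condMean_le_condMean x fun a y ha => ?_
  have hw2 := h.norm_sub_wStar_le hp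
  obtain ⟨w, u⟩ := p
  obtain ⟨dw, du, e, h1, h2, -⟩ := h.exists_step_eq y ha hα hα1 hβ hp.1 hp.2
  set G := incBound ρmax rmax Rw Ru with hG
  have hG0 : 0 < G := h.incBound_pos
  have hρ := h.ρmax_pos
  have hRw := h.Rw_pos
  rw [e]
  have h3 : ‖ballProj Rw (w + dw) - M.wStar‖ ≤ ‖(w - M.wStar) + dw‖ := by
    refine (norm_ballProj_sub_le h.Rw_pos.le _ h.wStar).trans (le_of_eq ?_)
    congr 1
    abel
  have h4 := pow_le_pow_left₀ (norm_nonneg _) h3 2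
  have h5 := norm_add_sq_le_of_approx hw2 h1 h2
  have h6 : (inner ℝ (w - M.wStar) (M.dirW x a y w u) : ℝ)
      - inner ℝ (w - M.wStar) (M.dirW x a y w (M.uStar w))
      ≤ (2 * Rw) * (ρmax * ‖M.trackErr (w, u)‖) := by
    rw [← inner_sub_right]
    refine (real_inner_le_norm _ _).trans (mul_le_mul hw2 ?_ (norm_nonneg _) (by positivity))
    refine (h.norm_dirW_sub_le y ha _ _ _ _).trans (le_of_eq ?_)
    rw [sub_self, norm_zero, mul_zero, zero_add, trackErr]
  have h7 := mul_le_mul_of_nonneg_left h6 (mul_nonneg zero_le_two hα.le)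
  have e2 : remW ρmax rmax Rw Ru * cα ^ 2 = cα ^ 2 * (2 * (2 * Rw) * G + G ^ 2) := by
    rw [remW]
    ring
  rw [e2]
  simp only at hw2 h4 h5 ⊢
  linarith

end Standing
end TDCProblem

/-! ### Geometric recursions -/

/-- Solution of a contracting recursion with a constant and a geometrically decaying perturbation. -/
theorem le_of_geometric_recursion {a : ℕ → ℝ} {q c e s : ℝ} (hq0 : 0 ≤ q) (hq1 : q < 1)
    (hs0 : 0 ≤ s) (hs1 : s < 1) (he : 0 ≤ e)
    (h : ∀ n, a (n + 1) ≤ q * a n + c + e * s ^ n) (hc : 0 ≤ c) (n : ℕ) :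
    a n ≤ q ^ n * a 0 + c / (1 - q) + e / (1 - s) := by
  -- the transient terms add up to at most `e ∑ s^k = e (1 - s^n) / (1 - s)`
  have key : a n ≤ q ^ n * a 0 + c / (1 - q) + e * (1 - s ^ n) / (1 - s) := by
    have hq : 0 < 1 - q := by linarith
    have hs : 0 < 1 - s := by linarith
    induction n with
    | zero =>
      have : 0 ≤ c / (1 - q) := by positivity
      simpa using this
    | succ n ih =>
      have h0 : 0 ≤ e * (1 - s ^ n) / (1 - s) :=
        div_nonneg (mul_nonneg he (by linarith [pow_le_one₀ (n := n) hs0 hs1.le])) hs.le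
      have h1 := mul_le_mul_of_nonneg_left ih hq0
      have h2 : q * (e * (1 - s ^ n) / (1 - s)) ≤ e * (1 - s ^ n) / (1 - s) :=
        mul_le_of_le_one_left h0 hq1.le
      have h3 : q * (c / (1 - q)) + c = c / (1 - q) := by field_simp; ring
      have h4 : e * (1 - s ^ n) / (1 - s) + e * s ^ n = e * (1 - s ^ (n + 1)) / (1 - s) := by
        field_simp; ring
      have h5 := h n
      rw [pow_succ']
      linarith
  refine key.trans (add_le_add le_rfl ?_)
  refine div_le_div_of_nonneg_right ?_ (by linarith)
  exact mul_le_of_le_one_right he (by linarith [pow_nonneg hs0 n])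

/-- The contraction factor `1 - c / (1 + c R) |l|` lies in `[0, 1)`, dominates `1 + c l`, and for
`c ≤ 1` stays away from `1` by a multiple of `c`. -/
theorem contraction_factor_bounds {c R l : ℝ} (hc : 0 < c) (hR : 0 < R) (hl : l < 0)
    (h : c * (|l| - R) < 1) :
    0 ≤ 1 - c / (1 + c * R) * |l| ∧ 1 - c / (1 + c * R) * |l| < 1 ∧
      1 + c * l ≤ 1 - c / (1 + c * R) * |l| ∧
      (c ≤ 1 → c * (|l| / (1 + R)) ≤ c / (1 + c * R) * |l|) := by
  have hl' : 0 < |l| := abs_pos.mpr hl.ne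
  have hd : 0 < 1 + c * R := by positivity
  have h1 : c / (1 + c * R) ≤ c := div_le_self hc.le (by nlinarith)
  refine ⟨?_, ?_, ?_, fun hc1 => ?_⟩
  · rw [sub_nonneg, div_mul_eq_mul_div, div_le_one hd]
    linarith
  · have : 0 < c / (1 + c * R) * |l| := by positivity
    linarith
  · have := mul_le_mul_of_nonneg_right h1 hl'.le
    rw [abs_of_neg hl] at this ⊢
    linarith
  · rw [mul_div_assoc', div_mul_eq_mul_div]
    refine div_le_div_of_nonneg_left (by positivity) hd (by nlinarith)

/-! ### The finite-time bounds -/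

namespace TDCProblem

variable {X A : Type*} [Fintype X] [Fintype A] {d : ℕ}

/-- Constant in the bound on the tracking error. -/
def constV (ρmax rmax lamc lamu Rw Ru : ℝ) : ℝ :=
  (4 * lipDriftU ρmax rmax lamc Rw Ru + 8 * Ru * incBound ρmax rmax Rw Ru
    + remV ρmax rmax lamc Rw Ru) * ((1 + ρmax) / |lamu|)

/-- Constant in the bound on `‖w - w_*‖²`. -/
def constW (ρmax rmax lamc lamu lamw Rw Ru : ℝ) : ℝ :=
  (4 * lipDriftW ρmax rmax lamc Rw Ru + 8 * Rw * incBound ρmax rmax Rw Ru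
    + remW ρmax rmax Rw Ru + 4 * Rw * ρmax) * ((1 + ρmax) / |lamw|)
    + 16 * Rw * Ru * ρmax * ((1 + ρmax) / |lamu|)

variable {M : TDCProblem X A d} {ρmax rmax lamc lamu lamw Rw Ru : ℝ} {cα cβ : ℝ}

namespace Standing

theorem lipDriftU_nonneg (h : M.Standing ρmax rmax lamc lamu lamw Rw Ru) :
    0 ≤ lipDriftU ρmax rmax lamc Rw Ru := by
  have := h.incBound_pos
  have := h.lipU_nonneg
  have := h.ρmax_pos
  have := h.Ru_pos
  unfold lipDriftU
  positivity

theorem lipDriftW_nonneg (h : M.Standing ρmax rmax lamc lamu lamw Rw Ru) :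
    0 ≤ lipDriftW ρmax rmax lamc Rw Ru := by
  have := h.incBound_pos
  have := h.lipU_nonneg
  have := h.ρmax_pos
  have := h.Rw_pos
  unfold lipDriftW
  positivity

theorem remV_nonneg (h : M.Standing ρmax rmax lamc lamu lamw Rw Ru) :
    0 ≤ remV ρmax rmax lamc Rw Ru := by
  have := h.incBound_pos
  have := h.lipU_nonneg
  have := h.Ru_pos
  unfold remV
  positivity

theorem remW_nonneg (h : M.Standing ρmax rmax lamc lamu lamw Rw Ru) :
    0 ≤ remW ρmax rmax Rw Ru := by
  have := h.incBound_pos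
  have := h.Rw_pos
  unfold remW
  positivity

variable {p₀ : Vec d × Vec d} {m ρ : ℝ}

/-- Trivial bound from the projection radius. -/
theorem expect_trackErr_sq_le_radius (h : M.Standing ρmax rmax lamc lamu lamw Rw Ru)
    (hp₀ : p₀ ∈ balls d Rw Ru) (n : ℕ) :
    M.expect (M.step cα cβ Rw Ru) p₀ n (fun p _ => ‖M.trackErr p‖ ^ 2) ≤ 4 * Ru ^ 2 := by
  refine (expect_le_expect (g := fun _ _ => 4 * Ru ^ 2) h.stationary h.isInvariant_balls hp₀ n
    fun p hp _ => ?_).trans (expect_const h.stationary n _).le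
  have := pow_le_pow_left₀ (norm_nonneg _) (h.norm_trackErr_le hp) 2
  linarith

/-- Trivial bound from the projection radius. -/
theorem expect_sub_wStar_sq_le_radius (h : M.Standing ρmax rmax lamc lamu lamw Rw Ru)
    (hp₀ : p₀ ∈ balls d Rw Ru) (n : ℕ) :
    M.expect (M.step cα cβ Rw Ru) p₀ n (fun p _ => ‖p.1 - M.wStar‖ ^ 2) ≤ 4 * Rw ^ 2 := by
  refine (expect_le_expect (g := fun _ _ => 4 * Rw ^ 2) h.stationary h.isInvariant_balls hp₀ n
    fun p hp _ => ?_).trans (expect_const h.stationary n _).le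
  have := pow_le_pow_left₀ (norm_nonneg _) (h.norm_sub_wStar_le hp) 2
  linarith

theorem expect_norm_trackErr_le (h : M.Standing ρmax rmax lamc lamu lamw Rw Ru)
    (hp₀ : p₀ ∈ balls d Rw Ru) {q Cv : ℝ} (hq0 : 0 ≤ q) (hCv : 0 ≤ Cv) {n : ℕ}
    (hV : M.expect (M.step cα cβ Rw Ru) p₀ n (fun p _ => ‖M.trackErr p‖ ^ 2)
      ≤ q ^ n * ‖M.trackErr p₀‖ ^ 2 + Cv) :
    M.expect (M.step cα cβ Rw Ru) p₀ n (fun p _ => ‖M.trackErr p‖) ≤ 2 * Ru * √q ^ n + √Cv := by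
  have hRu := h.Ru_pos
  refine le_of_sq_le_sq ((sq_expect_le h.stationary h.isInvariant_balls hp₀ n _).trans
    (hV.trans ?_)) (by positivity)
  have h1 : q ^ n * ‖M.trackErr p₀‖ ^ 2 ≤ q ^ n * (2 * Ru) ^ 2 :=
    mul_le_mul_of_nonneg_left (pow_le_pow_left₀ (norm_nonneg _) (h.norm_trackErr_le hp₀) 2)
      (pow_nonneg hq0 n)
  have h2 : (√q ^ n) ^ 2 = q ^ n := by rw [← pow_mul, mul_comm, pow_mul, Real.sq_sqrt hq0]
  have h3 : √Cv ^ 2 = Cv := Real.sq_sqrt hCv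
  have h4 : 0 ≤ 2 * (2 * Ru * √q ^ n) * √Cv := by positivity
  have e : (2 * Ru * √q ^ n + √Cv) ^ 2
      = (√q ^ n) ^ 2 * (2 * Ru) ^ 2 + 2 * (2 * Ru * √q ^ n) * √Cv + √Cv ^ 2 := by ring
  rw [e, h2, h3]
  linarith

variable [DecidableEq X]

theorem expect_trackErr_sq_succ_le (h : M.Standing ρmax rmax lamc lamu lamw Rw Ru)
    (hmix : M.GeomMixing m ρ) (hα : 0 < cα) (hαβ : cα ≤ cβ) (hβ1 : cβ ≤ 1)
    (hcβ : cβ * (|lamu| - ρmax) < 1) (hp₀ : p₀ ∈ balls d Rw Ru) (n : ℕ) :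
    M.expect (M.step cα cβ Rw Ru) p₀ (n + 1) (fun p _ => ‖M.trackErr p‖ ^ 2)
      ≤ (1 - cβ / (1 + cβ * ρmax) * |lamu|)
          * M.expect (M.step cα cβ Rw Ru) p₀ n (fun p _ => ‖M.trackErr p‖ ^ 2)
        + (4 * lipDriftU ρmax rmax lamc Rw Ru + 8 * Ru * incBound ρmax rmax Rw Ru
          + remV ρmax rmax lamc Rw Ru) * (cβ ^ 2 * mixingTime m ρ cβ + cα) := by
  have hβ := hα.trans_le hαβ
  obtain ⟨hτ1, hτ⟩ := mixingTime_spec hmix hβ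
  obtain ⟨hq0, hq1, hq, -⟩ := contraction_factor_bounds hβ h.ρmax_pos h.solvable.lamu_neg hcβ
  set q := 1 - cβ / (1 + cβ * ρmax) * |lamu| with hqdef
  set τ := mixingTime m ρ cβ with hτdef
  set D := lipDriftU ρmax rmax lamc Rw Ru with hD
  set K₁ := remV ρmax rmax lamc Rw Ru with hK₁
  set B := 2 * Ru * incBound ρmax rmax Rw Ru with hB
  have hD0 : 0 ≤ D := h.lipDriftU_nonneg
  have hK0 : 0 ≤ K₁ := h.remV_nonneg
  have hB0 : 0 ≤ B := by
    have := h.incBound_pos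
    have := h.Ru_pos
    positivity
  have hmixing := expect_sub_mean_le (θ₀ := p₀) (F := M.step cα cβ Rw Ru) (f := M.driftU)
    (Δ := cβ * D) (B := B) (ε := cβ) (τ := τ) h.stationary h.isInvariant_balls hp₀
    (fun p hp x a y z ha => h.abs_driftU_step_sub_le hα hαβ hβ1 hp y z ha)
    (fun p hp z => h.abs_driftU_le hp z) (by positivity) hB0 hβ.le hτ n
  rw [expect_succ]
  have hle : M.expect (M.step cα cβ Rw Ru) p₀ n
        (M.transfer (M.step cα cβ Rw Ru) fun p _ => ‖M.trackErr p‖ ^ 2)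
      ≤ M.expect (M.step cα cβ Rw Ru) p₀ n (fun p x => q * ‖M.trackErr p‖ ^ 2
        + (2 * cβ * (M.driftU p x - ∑ z, M.mu z * M.driftU p z) + K₁ * (cα + cβ ^ 2))) := by
    refine expect_le_expect h.stationary h.isInvariant_balls hp₀ n fun p hp x => ?_
    have h1 := h.transfer_trackErr_sq_le hα (hαβ.trans hβ1) hβ hβ1 hp x
    have h2 := mul_le_mul_of_nonneg_left (h.two_mul_sum_mu_driftU_le p) hβ.le
    have h3 := mul_le_mul_of_nonneg_right hq (sq_nonneg ‖M.trackErr p‖)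
    linarith
  rw [expect_add n (fun p _ => q * ‖M.trackErr p‖ ^ 2),
    expect_add n (fun p x => 2 * cβ * (M.driftU p x - ∑ z, M.mu z * M.driftU p z)),
    expect_const h.stationary, expect_const_mul n q (fun p _ => ‖M.trackErr p‖ ^ 2),
    expect_const_mul] at hle
  have hτR : (1 : ℝ) ≤ τ := by exact_mod_cast hτ1
  have h4 := mul_le_mul_of_nonneg_left hmixing (by positivity : 0 ≤ 2 * cβ)
  have h5 : cβ ^ 2 * 1 ≤ cβ ^ 2 * τ := mul_le_mul_of_nonneg_left hτR (sq_nonneg _)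
  have h6 := mul_le_mul_of_nonneg_left h5 hB0
  have h7 := mul_le_mul_of_nonneg_left h5 hK0
  have h8 : 0 ≤ (4 * D + 4 * B) * cα := by positivity
  have e : (4 * D + 8 * Ru * incBound ρmax rmax Rw Ru + K₁) * (cβ ^ 2 * τ + cα)
      = 4 * D * (cβ ^ 2 * τ) + 4 * (B * (cβ ^ 2 * τ)) + K₁ * (cβ ^ 2 * τ) + K₁ * cα
        + (4 * D + 4 * B) * cα := by
    rw [hB]
    ring
  rw [e]
  linarith

theorem expect_trackErr_sq_le (h : M.Standing ρmax rmax lamc lamu lamw Rw Ru)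
    (hmix : M.GeomMixing m ρ) (hα : 0 < cα) (hαβ : cα ≤ cβ) (hβ1 : cβ ≤ 1)
    (hcβ : cβ * (|lamu| - ρmax) < 1) (hp₀ : p₀ ∈ balls d Rw Ru) (n : ℕ) :
    M.expect (M.step cα cβ Rw Ru) p₀ n (fun p _ => ‖M.trackErr p‖ ^ 2)
      ≤ (1 - cβ / (1 + cβ * ρmax) * |lamu|) ^ n * ‖M.trackErr p₀‖ ^ 2
        + constV ρmax rmax lamc lamu Rw Ru * (cβ * mixingTime m ρ cβ + cα / cβ) := by
  have hβ := hα.trans_le hαβ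
  obtain ⟨hq0, hq1, -, hq⟩ := contraction_factor_bounds hβ h.ρmax_pos h.solvable.lamu_neg hcβ
  have hq := hq hβ1
  have hrec := h.expect_trackErr_sq_succ_le hmix hα hαβ hβ1 hcβ hp₀
  set q := 1 - cβ / (1 + cβ * ρmax) * |lamu| with hqdef
  set τ := mixingTime m ρ cβ with hτdef
  set K₁ := 4 * lipDriftU ρmax rmax lamc Rw Ru + 8 * Ru * incBound ρmax rmax Rw Ru
          + remV ρmax rmax lamc Rw Ru with hK₁
  have hρ := h.ρmax_pos
  have hl : 0 < |lamu| := abs_pos.mpr h.solvable.lamu_neg.ne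
  have hK0 : 0 ≤ K₁ := by
    have := h.incBound_pos
    have := h.lipDriftU_nonneg
    have := h.remV_nonneg
    have := h.Ru_pos
    positivity
  have h1 := le_of_geometric_recursion (c := K₁ * (cβ ^ 2 * τ + cα)) (e := 0) (s := 0)
    (a := fun n => M.expect (M.step cα cβ Rw Ru) p₀ n (fun p _ => ‖M.trackErr p‖ ^ 2))
    hq0 hq1 le_rfl one_pos le_rfl (fun n => by simpa using hrec n) (by positivity) n
  have h0 : M.expect (M.step cα cβ Rw Ru) p₀ 0 (fun p _ => ‖M.trackErr p‖ ^ 2)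
      = ‖M.trackErr p₀‖ ^ 2 := by
    simp [expect, ← Finset.sum_mul, h.stationary.sum_one]
  rw [h0, zero_div, add_zero] at h1
  refine h1.trans (add_le_add le_rfl ?_)
  have h2 : K₁ * (cβ ^ 2 * τ + cα) / (1 - q)
      ≤ K₁ * (cβ ^ 2 * τ + cα) / (cβ * (|lamu| / (1 + ρmax))) :=
    div_le_div_of_nonneg_left (by positivity) (by positivity) (by linarith)
  refine h2.trans (le_of_eq ?_)
  rw [constV, ← hK₁]
  field_simp

theorem expect_sub_wStar_sq_succ_le (h : M.Standing ρmax rmax lamc lamu lamw Rw Ru)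
    (hmix : M.GeomMixing m ρ) (hα : 0 < cα) (hα1 : cα ≤ 1) (hβ : 0 < cβ)
    (hcα : cα * (|lamw| - ρmax) < 1) (hp₀ : p₀ ∈ balls d Rw Ru) (n : ℕ) :
    M.expect (M.step cα cβ Rw Ru) p₀ (n + 1) (fun p _ => ‖p.1 - M.wStar‖ ^ 2)
      ≤ (1 - cα / (1 + cα * ρmax) * |lamw|)
          * M.expect (M.step cα cβ Rw Ru) p₀ n (fun p _ => ‖p.1 - M.wStar‖ ^ 2)
        + (4 * lipDriftW ρmax rmax lamc Rw Ru + 8 * Rw * incBound ρmax rmax Rw Ru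
          + remW ρmax rmax Rw Ru) * (cα ^ 2 * mixingTime m ρ cα)
        + 4 * Rw * ρmax * cα
          * M.expect (M.step cα cβ Rw Ru) p₀ n (fun p _ => ‖M.trackErr p‖) := by
  obtain ⟨hτ1, hτ⟩ := mixingTime_spec hmix hα
  obtain ⟨hq0, hq1, hq, -⟩ := contraction_factor_bounds hα h.ρmax_pos h.solvable.lamw_neg hcα
  set q := 1 - cα / (1 + cα * ρmax) * |lamw| with hqdef
  set τ := mixingTime m ρ cα with hτdef
  set D := lipDriftW ρmax rmax lamc Rw Ru with hD
  set K₁ := remW ρmax rmax Rw Ru with hK₁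
  set B := 2 * Rw * incBound ρmax rmax Rw Ru with hB
  have hD0 : 0 ≤ D := h.lipDriftW_nonneg
  have hK0 : 0 ≤ K₁ := h.remW_nonneg
  have hB0 : 0 ≤ B := by
    have := h.incBound_pos
    have := h.Rw_pos
    positivity
  have hmixing := expect_sub_mean_le (θ₀ := p₀) (F := M.step cα cβ Rw Ru) (f := M.driftW)
    (Δ := cα * D) (B := B) (ε := cα) (τ := τ) h.stationary h.isInvariant_balls hp₀
    (fun p hp x a y z ha => h.abs_driftW_step_sub_le hα hα1 hβ hp y z ha)
    (fun p hp z => h.abs_driftW_le hp z) (by positivity) hB0 hα.le hτ n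
  rw [expect_succ]
  have hle : M.expect (M.step cα cβ Rw Ru) p₀ n
        (M.transfer (M.step cα cβ Rw Ru) fun p _ => ‖p.1 - M.wStar‖ ^ 2)
      ≤ M.expect (M.step cα cβ Rw Ru) p₀ n (fun p x => q * ‖p.1 - M.wStar‖ ^ 2
        + (2 * cα * (M.driftW p x - ∑ z, M.mu z * M.driftW p z)
        + (4 * Rw * ρmax * cα * ‖M.trackErr p‖ + K₁ * cα ^ 2))) := by
    refine expect_le_expect h.stationary h.isInvariant_balls hp₀ n fun p hp x => ?_
    have h1 := h.transfer_sub_wStar_sq_le hα hα1 hβ hp x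
    have h2 := mul_le_mul_of_nonneg_left (h.two_mul_sum_mu_driftW_le p) hα.le
    have h3 := mul_le_mul_of_nonneg_right hq (sq_nonneg ‖p.1 - M.wStar‖)
    linarith
  rw [expect_add n (fun (p : Vec d × Vec d) _ => q * ‖p.1 - M.wStar‖ ^ 2),
    expect_add n (fun p x => 2 * cα * (M.driftW p x - ∑ z, M.mu z * M.driftW p z)),
    expect_add n (fun p _ => 4 * Rw * ρmax * cα * ‖M.trackErr p‖),
    expect_const h.stationary, expect_const_mul n q (fun (p : Vec d × Vec d) _ => ‖p.1 - M.wStar‖ ^ 2),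
    expect_const_mul n _ (fun p _ => ‖M.trackErr p‖), expect_const_mul] at hle
  have hτR : (1 : ℝ) ≤ τ := by exact_mod_cast hτ1
  have h4 := mul_le_mul_of_nonneg_left hmixing (by positivity : 0 ≤ 2 * cα)
  have h5 : cα ^ 2 * 1 ≤ cα ^ 2 * τ := mul_le_mul_of_nonneg_left hτR (sq_nonneg _)
  have h6 := mul_le_mul_of_nonneg_left h5 hB0
  have h7 := mul_le_mul_of_nonneg_left h5 hK0
  have e : (4 * D + 8 * Rw * incBound ρmax rmax Rw Ru + K₁) * (cα ^ 2 * τ)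
      = 4 * D * (cα ^ 2 * τ) + 4 * (B * (cα ^ 2 * τ)) + K₁ * (cα ^ 2 * τ) := by
    rw [hB]
    ring
  rw [e]
  linarith

theorem expect_sub_wStar_sq_le (h : M.Standing ρmax rmax lamc lamu lamw Rw Ru)
    (hmix : M.GeomMixing m ρ) (hα : 0 < cα) (hαβ : cα ≤ cβ) (hβ1 : cβ ≤ 1)
    (hcα : cα * (|lamw| - ρmax) < 1) (hcβ : cβ * (|lamu| - ρmax) < 1)
    (hp₀ : p₀ ∈ balls d Rw Ru) {Cv : ℝ} (hCv : 0 ≤ Cv) (hCv' : cα / cβ ≤ √Cv)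
    (hV : ∀ n, M.expect (M.step cα cβ Rw Ru) p₀ n (fun p _ => ‖M.trackErr p‖ ^ 2)
      ≤ (1 - cβ / (1 + cβ * ρmax) * |lamu|) ^ n * ‖M.trackErr p₀‖ ^ 2 + Cv) (n : ℕ) :
    M.expect (M.step cα cβ Rw Ru) p₀ n (fun p _ => ‖p.1 - M.wStar‖ ^ 2)
      ≤ (1 - cα / (1 + cα * ρmax) * |lamw|) ^ n * ‖p₀.1 - M.wStar‖ ^ 2
        + constW ρmax rmax lamc lamu lamw Rw Ru * (cα * mixingTime m ρ cα + √Cv) := by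
  have hβ := hα.trans_le hαβ
  have hα1 := hαβ.trans hβ1
  obtain ⟨hq0, hq1, -, hq⟩ := contraction_factor_bounds hα h.ρmax_pos h.solvable.lamw_neg hcα
  obtain ⟨hs0, hs1, -, hs⟩ := contraction_factor_bounds hβ h.ρmax_pos h.solvable.lamu_neg hcβ
  have hq := hq hα1
  have hs := hs hβ1
  have hrec := h.expect_sub_wStar_sq_succ_le hmix hα hα1 hβ hcα hp₀
  have hE := fun n => h.expect_norm_trackErr_le hp₀ hs0 hCv (hV n)
  set q := 1 - cα / (1 + cα * ρmax) * |lamw| with hqdef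
  set r := 1 - cβ / (1 + cβ * ρmax) * |lamu| with hrdef
  set τ := mixingTime m ρ cα with hτdef
  set K₁ := 4 * lipDriftW ρmax rmax lamc Rw Ru + 8 * Rw * incBound ρmax rmax Rw Ru
          + remW ρmax rmax Rw Ru with hK₁
  have hρ := h.ρmax_pos
  have hRw := h.Rw_pos
  have hRu := h.Ru_pos
  have hlw : 0 < |lamw| := abs_pos.mpr h.solvable.lamw_neg.ne
  have hlu : 0 < |lamu| := abs_pos.mpr h.solvable.lamu_neg.ne
  have hK0 : 0 ≤ K₁ := by
    have := h.incBound_pos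
    have := h.lipDriftW_nonneg
    have := h.remW_nonneg
    positivity
  have hsq : √r < 1 := (Real.sqrt_lt' one_pos).mpr (by simpa using hs1)
  have h1 := le_of_geometric_recursion (c := K₁ * (cα ^ 2 * τ) + 4 * Rw * ρmax * cα * √Cv)
    (e := 8 * Rw * Ru * ρmax * cα) (s := √r) hq0 hq1 (Real.sqrt_nonneg _) hsq (by positivity)
    (fun n => by
      have h2 := mul_le_mul_of_nonneg_left (hE n) (by positivity : 0 ≤ 4 * Rw * ρmax * cα)
      have h3 := hrec n
      linarith) (by positivity) n
  have h0 : M.expect (M.step cα cβ Rw Ru) p₀ 0 (fun p _ => ‖p.1 - M.wStar‖ ^ 2)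
      = ‖p₀.1 - M.wStar‖ ^ 2 := by
    simp [expect, ← Finset.sum_mul, h.stationary.sum_one]
  rw [h0, add_assoc] at h1
  refine h1.trans (add_le_add le_rfl ?_)
  have h2 : (K₁ * (cα ^ 2 * τ) + 4 * Rw * ρmax * cα * √Cv) / (1 - q)
      ≤ (K₁ * (cα ^ 2 * τ) + 4 * Rw * ρmax * cα * √Cv) / (cα * (|lamw| / (1 + ρmax))) :=
    div_le_div_of_nonneg_left (by positivity) (by positivity) (by linarith)
  have e2 : (K₁ * (cα ^ 2 * τ) + 4 * Rw * ρmax * cα * √Cv) / (cα * (|lamw| / (1 + ρmax)))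
      = (K₁ * (cα * τ) + 4 * Rw * ρmax * √Cv) * ((1 + ρmax) / |lamw|) := by
    field_simp
  -- `1 - r = (1 - √r) (1 + √r) ≤ 2 (1 - √r)`
  have h3 : cβ * (|lamu| / (1 + ρmax)) / 2 ≤ 1 - √r := by
    have := Real.sq_sqrt hs0
    nlinarith [Real.sqrt_nonneg r]
  have h4 : 8 * Rw * Ru * ρmax * cα / (1 - √r)
      ≤ 8 * Rw * Ru * ρmax * cα / (cβ * (|lamu| / (1 + ρmax)) / 2) :=
    div_le_div_of_nonneg_left (by positivity) (by positivity) h3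
  have e4 : 8 * Rw * Ru * ρmax * cα / (cβ * (|lamu| / (1 + ρmax)) / 2)
      = 16 * Rw * Ru * ρmax * ((1 + ρmax) / |lamu|) * (cα / cβ) := by
    field_simp
    ring
  have h5 : 16 * Rw * Ru * ρmax * ((1 + ρmax) / |lamu|) * (cα / cβ)
      ≤ 16 * Rw * Ru * ρmax * ((1 + ρmax) / |lamu|) * √Cv :=
    mul_le_mul_of_nonneg_left hCv' (by positivity)
  have h6 : 0 ≤ K₁ * √Cv * ((1 + ρmax) / |lamw|) := by positivity
  have h7 : 0 ≤ 4 * Rw * ρmax * (cα * τ) * ((1 + ρmax) / |lamw|) := by positivity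
  have h8 : 0 ≤ 16 * Rw * Ru * ρmax * ((1 + ρmax) / |lamu|) * (cα * τ) := by positivity
  rw [constW, ← hK₁]
  rw [e2] at h2
  rw [e4] at h4
  linarith

end Standing
end TDCProblem

end

/-! ### Assembly of the bounds -/

theorem theorem7 (ρmax rmax lamc lamu lamw Rw Ru : ℝ)
    (hρmax : 0 < ρmax) (hrmax : 0 < rmax) (hRw : 0 < Rw) (hRu : 0 < Ru) :
    ∃ K : ℝ, 0 < K ∧
      ∀ (X A Ω : Type*) [Fintype X] [DecidableEq X] [Fintype A] [MeasurableSpace Ω]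
        (P : Measure Ω) [IsProbabilityMeasure P] (d : ℕ) (M : TDCProblem X A d)
        (x : ℕ → Ω → X) (a : ℕ → Ω → A),
        M.Ergodic → M.BoundedReward rmax → M.NormalizedFeatures → M.BoundedWeight ρmax →
        M.Solvable lamc lamu lamw → M.IsTrajectory P x a →
        ‖M.wStar‖ ≤ Rw → 2 * ρmax * (M.γ + 1) * Rw / lamc ≤ Ru →
        (∃ m ρ : ℝ, M.GeomMixing m ρ) ∧
        ∀ m ρ : ℝ, M.GeomMixing m ρ →
        ∀ cα cβ : ℝ, 0 < cα → 0 < cβ →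
          cα * (|lamw| - ρmax) < 1 → cβ * (|lamu| - ρmax) < 1 →
          ∃ Cv Cw : ℝ,
            (0 ≤ Cv ∧ Cv ≤ K *
              (max (cβ * mixingTime m ρ cβ) (cβ ^ 2 * mixingTime m ρ cβ)
                + max cα (cα ^ 2) + max (cα / cβ) (cα ^ 2 / cβ))) ∧
            (0 ≤ Cw ∧ Cw ≤ K *
              (max cα (cα ^ 4) + (√Cv + cα * √Cv)
                + max cα (cα ^ 3) * mixingTime m ρ cα)) ∧
            ∀ w₁ u₁ : Vec d, ‖w₁‖ ≤ Rw → ‖u₁‖ ≤ Ru → ∀ n : ℕ,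
              (∫ ω, ‖M.trackErr (M.iter cα cβ Rw Ru w₁ u₁ (fun k => x k ω) (fun k => a k ω) n)‖ ^ 2
                  ∂P
                ≤ (1 - cβ / (1 + cβ * ρmax) * |lamu|) ^ n * ‖M.trackErr (w₁, u₁)‖ ^ 2 + Cv) ∧
              (∫ ω, ‖(M.iter cα cβ Rw Ru w₁ u₁ (fun k => x k ω) (fun k => a k ω) n).1
                    - M.wStar‖ ^ 2 ∂P
                ≤ (1 - cα / (1 + cα * ρmax) * |lamw|) ^ n * ‖w₁ - M.wStar‖ ^ 2 + Cw) := by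
  set K₁ : ℝ := 4 * Ru ^ 2 + 1 + |TDCProblem.constV ρmax rmax lamc lamu Rw Ru| with hK₁
  set K₂ : ℝ := 4 * Rw ^ 2 + |TDCProblem.constW ρmax rmax lamc lamu lamw Rw Ru| with hK₂
  have hK₁1 : 1 ≤ K₁ := by
    have := abs_nonneg (TDCProblem.constV ρmax rmax lamc lamu Rw Ru)
    linarith [sq_nonneg Ru]
  have hK₂0 : 0 ≤ K₂ := by positivity
  refine ⟨K₁ + K₂, by linarith, ?_⟩
  intro X A Ω _ _ _ _ P _ d M x a herg hrew hfeat hwt hsol htraj hwStar hrad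
  have h : M.Standing ρmax rmax lamc lamu lamw Rw Ru :=
    ⟨hρmax, hrmax, hRw, hRu, herg.stationary, hrew, hfeat, hwt, hsol, hwStar, hrad⟩
  refine ⟨TDCProblem.exists_geomMixing herg, ?_⟩
  intro m ρ hmix cα cβ hα hβ hcα hcβ
  obtain ⟨hs0, -, -, -⟩ := contraction_factor_bounds hβ hρmax hsol.lamu_neg hcβ
  obtain ⟨hq0, -, -, -⟩ := contraction_factor_bounds hα hρmax hsol.lamw_neg hcα
  obtain ⟨hτβ, -⟩ := TDCProblem.mixingTime_spec hmix hβ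
  have hτβ' : (1 : ℝ) ≤ mixingTime m ρ cβ := by exact_mod_cast hτβ
  set bound : ℝ := max (cβ * mixingTime m ρ cβ) (cβ ^ 2 * mixingTime m ρ cβ)
    + max cα (cα ^ 2) + max (cα / cβ) (cα ^ 2 / cβ) with hbound
  have hb1 : cβ * mixingTime m ρ cβ ≤ max (cβ * mixingTime m ρ cβ) (cβ ^ 2 * mixingTime m ρ cβ) :=
    le_max_left _ _
  have hb2 : cα ≤ max cα (cα ^ 2) := le_max_left _ _
  have hb3 : cα / cβ ≤ max (cα / cβ) (cα ^ 2 / cβ) := le_max_left _ _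
  have hb4 : 0 < cα / cβ := by positivity
  have hb5 : 0 < cβ * mixingTime m ρ cβ := by positivity
  have hb : cβ * mixingTime m ρ cβ + cα / cβ ≤ bound := by linarith
  have hb0 : 0 ≤ bound := by linarith
  set Cv : ℝ := K₁ * bound with hCv
  have hCv0 : 0 ≤ Cv := by positivity
  have hCvb : bound ≤ Cv := le_mul_of_one_le_left hb0 hK₁1
  have hmaxα : 0 ≤ max cα (cα ^ 4) := hα.le.trans (le_max_left _ _)
  have hmaxα' : cα * mixingTime m ρ cα ≤ max cα (cα ^ 3) * mixingTime m ρ cα :=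
    mul_le_mul_of_nonneg_right (le_max_left _ _) (Nat.cast_nonneg _)
  have hατ : 0 ≤ cα * (mixingTime m ρ cα : ℝ) := by positivity
  have hαs : 0 ≤ cα * √Cv := by positivity
  have hCvle : Cv ≤ (K₁ + K₂) * bound := mul_le_mul_of_nonneg_right (by linarith) hb0
  have hV : ∀ (p : Vec d × Vec d) (n : ℕ),
      ∫ ω, ‖M.trackErr (M.iter cα cβ Rw Ru p.1 p.2 (fun k => x k ω) (fun k => a k ω) n)‖ ^ 2 ∂P
        = M.expect (M.step cα cβ Rw Ru) p n (fun p _ => ‖M.trackErr p‖ ^ 2) := fun p n =>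
    TDCProblem.integral_eq_expect htraj (th := M.iter cα cβ Rw Ru p.1 p.2)
      (fun _ _ => rfl) (fun _ _ _ => rfl) (fun p _ => ‖M.trackErr p‖ ^ 2) n
  have hW : ∀ (p : Vec d × Vec d) (n : ℕ),
      ∫ ω, ‖(M.iter cα cβ Rw Ru p.1 p.2 (fun k => x k ω) (fun k => a k ω) n).1
          - M.wStar‖ ^ 2 ∂P
        = M.expect (M.step cα cβ Rw Ru) p n (fun p _ => ‖p.1 - M.wStar‖ ^ 2) := fun p n =>
    TDCProblem.integral_eq_expect htraj (th := M.iter cα cβ Rw Ru p.1 p.2)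
      (fun _ _ => rfl) (fun _ _ _ => rfl) (fun p _ => ‖p.1 - M.wStar‖ ^ 2) n
  by_cases hcase : cα ≤ cβ ∧ cβ ≤ 1
  · obtain ⟨hαβ, hβ1⟩ := hcase
    have hexpV : ∀ p ∈ TDCProblem.balls d Rw Ru, ∀ n,
        M.expect (M.step cα cβ Rw Ru) p n (fun p _ => ‖M.trackErr p‖ ^ 2)
          ≤ (1 - cβ / (1 + cβ * ρmax) * |lamu|) ^ n * ‖M.trackErr p‖ ^ 2 + Cv := by
      intro p hp n
      refine (h.expect_trackErr_sq_le hmix hα hαβ hβ1 hcβ hp n).trans (add_le_add le_rfl ?_)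
      refine mul_le_mul ?_ hb (by positivity) (by linarith)
      have := le_abs_self (TDCProblem.constV ρmax rmax lamc lamu Rw Ru)
      linarith [sq_nonneg Ru]
    -- as `cα ≤ cβ`, the ratio `cα / cβ` is at most its square root
    have hratio : cα / cβ ≤ √Cv := by
      refine Real.le_sqrt_of_sq_le ?_
      have h1 : (cα / cβ) ^ 2 ≤ cα / cβ :=
        pow_le_of_le_one hb4.le ((div_le_one hβ).mpr hαβ) two_ne_zero
      linarith
    refine ⟨Cv, K₂ * (cα * mixingTime m ρ cα + √Cv), ⟨hCv0, hCvle⟩, ⟨by positivity, ?_⟩, ?_⟩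
    · refine mul_le_mul (by linarith) ?_ (by positivity) (by linarith)
      linarith
    · intro w₁ u₁ hw hu n
      have hp : ((w₁, u₁) : Vec d × Vec d) ∈ TDCProblem.balls d Rw Ru := ⟨hw, hu⟩
      refine ⟨(hV (w₁, u₁) n).le.trans (hexpV _ hp n), (hW (w₁, u₁) n).le.trans ?_⟩
      refine (h.expect_sub_wStar_sq_le hmix hα hαβ hβ1 hcα hcβ hp hCv0 hratio (hexpV _ hp)
        n).trans (add_le_add le_rfl (mul_le_mul_of_nonneg_right ?_ (by positivity)))
      have := le_abs_self (TDCProblem.constW ρmax rmax lamc lamu lamw Rw Ru)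
      linarith [sq_nonneg Rw]
  · -- one of `cα / cβ` and `cβ` exceeds `1`, and the claimed bounds exceed the squared diameters
    have hb1' : 1 ≤ bound := by
      rcases not_and_or.mp hcase with h1 | h1
      · have : 1 < cα / cβ := (one_lt_div hβ).mpr (not_le.mp h1)
        linarith
      · have : 1 ≤ cβ * (mixingTime m ρ cβ : ℝ) := one_le_mul_of_one_le_of_one_le (not_le.mp h1).le hτβ'
        linarith
    have hs1 : 1 ≤ √Cv := Real.one_le_sqrt.mpr (hb1'.trans hCvb)
    refine ⟨Cv, 4 * Rw ^ 2, ⟨hCv0, hCvle⟩, ⟨by positivity, ?_⟩, ?_⟩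
    · calc 4 * Rw ^ 2 ≤ (K₁ + K₂) * 1 := by
            have := abs_nonneg (TDCProblem.constW ρmax rmax lamc lamu lamw Rw Ru)
            linarith
        _ ≤ _ := mul_le_mul_of_nonneg_left (by linarith) (by linarith)
    · intro w₁ u₁ hw hu n
      have hp : ((w₁, u₁) : Vec d × Vec d) ∈ TDCProblem.balls d Rw Ru := ⟨hw, hu⟩
      constructor
      · refine (hV (w₁, u₁) n).le.trans ((h.expect_trackErr_sq_le_radius hp n).trans ?_)
        have h1 : 0 ≤ (1 - cβ / (1 + cβ * ρmax) * |lamu|) ^ n * ‖M.trackErr (w₁, u₁)‖ ^ 2 :=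
          mul_nonneg (pow_nonneg hs0 n) (sq_nonneg _)
        have h2 : 4 * Ru ^ 2 ≤ K₁ := by
          have := abs_nonneg (TDCProblem.constV ρmax rmax lamc lamu Rw Ru)
          linarith
        have h3 : K₁ * 1 ≤ Cv := mul_le_mul_of_nonneg_left hb1' (by linarith)
        linarith
      · refine (hW (w₁, u₁) n).le.trans ((h.expect_sub_wStar_sq_le_radius hp n).trans ?_)
        have h1 : 0 ≤ (1 - cα / (1 + cα * ρmax) * |lamw|) ^ n * ‖w₁ - M.wStar‖ ^ 2 :=
          mul_nonneg (pow_nonneg hq0 n) (sq_nonneg _)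
        linarith
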